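/- All Hilbert spaces are finite-dimensional, $S(\rho)=-\mathrm{Tr}\,\rho\log\rho$ is the von Neumann entropy (natural logarithm, $0\log 0=0$), $H(p)=-\sum_i p_i\log p_i$, and $S_X$ denotes the entropy of the reduced state on the subsystem $X$; $I_{A:B}=S_A+S_B-S_{AB}$ and $I_{A:B|V}=S_{AV}+S_{BV}-S_{ABV}-S_V$. An extension of a state $\rho_{AB}$ is a state $\rho_{ABV}$, with $V$ of arbitrary finite dimension, such that $\mathrm{Tr}_V\rho_{ABV}=\rho_{AB}$. Put $$E_P(\rho_{AB})=\inf S_{AV},\qquad E_Q(\rho_{AB})=\inf \tfrac12\,(S_A+S_B+S_{AV}-S_{BV}),$$ $$E_R(\rho_{AB})=\inf \tfrac12\,(S_{AB}+2S_{AV}-S_{ABV}-S_V),\qquad E_{sq}(\rho_{AB})=\inf \tfrac12\, I_{A:B|V},$$ each infimum being over all extensions $\rho_{ABV}$ of $\rho_{AB}$. 1. (Pure states.) For every pure state $|\psi\rangle_{AB}$, $E_P=E_Q=E_R=S_A=S_B$. 2. (Classically correlated states.) For every probability distribution $(p_i)$, the state $\rho_{AB}=\sum_i p_i|ii\rangle\langle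 ii|$ satisfies $S_A=I_{A:B}=H(p)$, $E_P=E_Q=H(p)$ and $E_R=\tfrac12 H(p)$. 3. (Symmetric or antisymmetric states.) Let $\mathcal H_A=\mathcal H_B$ and let $\rho_{AB}$ be a state whose support lies in the symmetric subspace, or in the antisymmetric subspace, of $\mathcal H_A\otimes\mathcal H_B$. Then every extension is swap invariant, $(F_{AB}\otimes I_V)\,\rho_{ABV}\,(F_{AB}^\dagger\otimes I_V)=\rho_{ABV}$ with $F_{AB}=\sum_{ij}|ij\rangle\langle ji|$, and has $S_{AV}=S_{BV}$. Moreover $E_P=E_Q=S_A$ and $E_R=\tfrac12 S_{AB}+E_{sq}$. 4. $E_P$ is additive on the class of states in 3: if $\rho_{A_1B_1}$ and $\tau_{A_2B_2}$ both belong to this class, then $E_P(\rho_{A_1B_1}\otimes\tau_{A_2B_2})=E_P(\rho_{A_1B_1})+E_P(\tau_{A_2B_2})$, where the product is regarded as a bipartite state of $A_1A_2$ and $B_1B_2$. -/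

import Mathlib

open scoped Kronecker ComplexOrder

noncomputable section

namespace QCorr

/-- A density operator on the Hilbert space `ℂ^A`: positive semidefinite with unit trace. -/
structure IsState {A : Type*} [Fintype A] (ρ : Matrix A A ℂ) : Prop where
  posSemidef : ρ.PosSemidef
  trace_eq_one : ρ.trace = 1

/-- The von Neumann entropy `S(ρ) = -Tr (ρ log ρ)` (natural logarithm). The logarithm is taken
by functional calculus; as `Real.log 0 = 0`, the usual convention `0 log 0 = 0` holds. -/
def entropy {A : Type*} [Fintype A] [DecidableEq A] (ρ : Matrix A A ℂ) : ℝ :=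
  -((ρ * cfc Real.log ρ).trace).re

/-- The Shannon entropy `H(p) = -∑ i, p i log (p i)`. -/
def shannon {ι : Type*} [Fintype ι] (p : ι → ℝ) : ℝ :=
  -∑ i, p i * Real.log (p i)

/-- The partial trace over the second factor. -/
def trRight {X Y : Type*} [Fintype Y] (ρ : Matrix (X × Y) (X × Y) ℂ) : Matrix X X ℂ :=
  Matrix.of fun x x' => ∑ y, ρ (x, y) (x', y)

/-- The partial trace over the first factor. -/
def trLeft {X Y : Type*} [Fintype X] (ρ : Matrix (X × Y) (X × Y) ℂ) : Matrix Y Y ℂ :=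
  Matrix.of fun y y' => ∑ x, ρ (x, y) (x, y')

section Tripartite

variable {A B V : Type*}

/-- The marginal on `AV` of an operator on `ABV`. -/
def margAV [Fintype B] (σ : Matrix ((A × B) × V) ((A × B) × V) ℂ) : Matrix (A × V) (A × V) ℂ :=
  Matrix.of fun x x' => ∑ b, σ ((x.1, b), x.2) ((x'.1, b), x'.2)

/-- The marginal on `BV` of an operator on `ABV`. -/
def margBV [Fintype A] (σ : Matrix ((A × B) × V) ((A × B) × V) ℂ) : Matrix (B × V) (B × V) ℂ :=
  Matrix.of fun x x' => ∑ a, σ ((a, x.1), x.2) ((a, x'.1), x'.2)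

/-- `σ` is an extension to `ABV` of the operator `ρ` on `AB`: a state with `Tr_V σ = ρ`. -/
structure IsExtension [Fintype A] [Fintype B] [Fintype V]
    (ρ : Matrix (A × B) (A × B) ℂ) (σ : Matrix ((A × B) × V) ((A × B) × V) ℂ) : Prop where
  isState : IsState σ
  trRight_eq : trRight σ = ρ

variable [Fintype A] [Fintype B] [Fintype V] [DecidableEq A] [DecidableEq B] [DecidableEq V]

/-- The mutual information `I_{A:B} = S_A + S_B - S_{AB}`. -/
def mutualInfo (ρ : Matrix (A × B) (A × B) ℂ) : ℝ :=
  entropy (trRight ρ) + entropy (trLeft ρ) - entropy ρ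

/-- The conditional mutual information `I_{A:B|V} = S_{AV} + S_{BV} - S_{ABV} - S_V`. -/
def condMutualInfo (σ : Matrix ((A × B) × V) ((A × B) × V) ℂ) : ℝ :=
  entropy (margAV σ) + entropy (margBV σ) - entropy σ - entropy (trLeft σ)

/-- `f^P = S_{AV}`. -/
def fP (σ : Matrix ((A × B) × V) ((A × B) × V) ℂ) : ℝ :=
  entropy (margAV σ)

/-- `f^Q = (S_A + S_B + S_{AV} - S_{BV}) / 2`. -/
def fQ (σ : Matrix ((A × B) × V) ((A × B) × V) ℂ) : ℝ :=
  (1 / 2) * (entropy (trRight (trRight σ)) + entropy (trLeft (trRight σ))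
    + entropy (margAV σ) - entropy (margBV σ))

/-- `f^R = (S_{AB} + 2 S_{AV} - S_{ABV} - S_V) / 2`. -/
def fR (σ : Matrix ((A × B) × V) ((A × B) × V) ℂ) : ℝ :=
  (1 / 2) * (entropy (trRight σ) + 2 * entropy (margAV σ) - entropy σ - entropy (trLeft σ))

end Tripartite

section Measures

variable {A B : Type*} [Fintype A] [Fintype B] [DecidableEq A] [DecidableEq B]

/-- The infimum of `f` over all extensions `ρ_{ABV}` of `ρ` with `V = ℂ^n` of arbitrary finite
dimension. It is taken in the extended reals, so that it is a genuine infimum. -/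
def infExt (f : ∀ n : ℕ, Matrix ((A × B) × Fin n) ((A × B) × Fin n) ℂ → ℝ)
    (ρ : Matrix (A × B) (A × B) ℂ) : EReal :=
  ⨅ (n : ℕ) (σ : Matrix ((A × B) × Fin n) ((A × B) × Fin n) ℂ) (_ : IsExtension ρ σ),
    (f n σ : EReal)

/-- The entanglement of purification. -/
def EP (ρ : Matrix (A × B) (A × B) ℂ) : EReal := infExt (fun _ σ => fP σ) ρ

/-- The correlation measure `E_Q`. -/
def EQ (ρ : Matrix (A × B) (A × B) ℂ) : EReal := infExt (fun _ σ => fQ σ) ρ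

/-- The correlation measure `E_R`. -/
def ER (ρ : Matrix (A × B) (A × B) ℂ) : EReal := infExt (fun _ σ => fR σ) ρ

/-- The squashed entanglement, `inf I_{A:B|V} / 2`. -/
def Esq (ρ : Matrix (A × B) (A × B) ℂ) : EReal :=
  infExt (fun _ σ => (1 / 2) * condMutualInfo σ) ρ

end Measures

/-- The operator `|ψ⟩⟨ψ|`. -/
def pureOp {X : Type*} (ψ : X → ℂ) : Matrix X X ℂ :=
  Matrix.vecMulVec ψ (star ψ)

section Examples

variable {ι : Type*} [DecidableEq ι]

/-- The classically correlated state `∑ i, p i |ii⟩⟨ii|`. -/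
def classicalState [Fintype ι] (p : ι → ℝ) : Matrix (ι × ι) (ι × ι) ℂ :=
  ∑ i, (p i : ℂ) • pureOp (Pi.single (i, i) 1)

/-- The swap operator `F = ∑ i j, |ij⟩⟨ji|`. -/
def swapOp : Matrix (ι × ι) (ι × ι) ℂ :=
  Matrix.of fun x y => if x = y.swap then 1 else 0

variable (ι) in
/-- The symmetric subspace of `ℂ^ι ⊗ ℂ^ι`. -/
def symSubspace : Submodule ℂ (ι × ι → ℂ) where
  carrier := {x | ∀ i j, x (j, i) = x (i, j)}
  add_mem' := fun hx hy i j => by simp only [Pi.add_apply, hx i j, hy i j]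
  zero_mem' := fun _ _ => rfl
  smul_mem' := fun c x hx i j => by simp only [Pi.smul_apply, hx i j]

variable (ι) in
/-- The antisymmetric subspace of `ℂ^ι ⊗ ℂ^ι`. -/
def antisymSubspace : Submodule ℂ (ι × ι → ℂ) where
  carrier := {x | ∀ i j, x (j, i) = -x (i, j)}
  add_mem' := fun hx hy i j => by
    simp only [Pi.add_apply, hx i j, hy i j]
    ring
  zero_mem' := fun _ _ => by simp
  smul_mem' := fun c x hx i j => by simp only [Pi.smul_apply, hx i j, smul_neg]

/-- A state on `ℂ^ι ⊗ ℂ^ι` whose support lies within the symmetric subspace, or within the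
antisymmetric subspace. The support of a positive semidefinite operator is its range. -/
structure IsSymOrAntisymState [Fintype ι] (ρ : Matrix (ι × ι) (ι × ι) ℂ) : Prop where
  isState : IsState ρ
  support_le : LinearMap.range ρ.mulVecLin ≤ symSubspace ι ∨
    LinearMap.range ρ.mulVecLin ≤ antisymSubspace ι

end Examples

/-- The tensor product of an operator on `A₁B₁` and one on `A₂B₂`, as an operator on the bipartite
system with parts `A₁A₂` and `B₁B₂`. -/
def bipartiteTensor {A₁ B₁ A₂ B₂ : Type*} (ρ : Matrix (A₁ × B₁) (A₁ × B₁) ℂ)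
    (τ : Matrix (A₂ × B₂) (A₂ × B₂) ℂ) :
    Matrix ((A₁ × A₂) × (B₁ × B₂)) ((A₁ × A₂) × (B₁ × B₂)) ℂ :=
  Matrix.of fun x y => ρ (x.1.1, x.2.1) (y.1.1, y.2.1) * τ (x.1.2, x.2.2) (y.1.2, y.2.2)

end QCorr

end

open scoped Kronecker ComplexOrder

noncomputable section

set_option linter.unusedSectionVars false

namespace QCorr

open Matrix Filter Topology

/-! Support rigidity and strong subadditivity carry the result. If `K` annihilates the marginal of a
positive operator, then `K ⊗ 1` annihilates the operator itself (`kronecker_one_mul_eq_zero`).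

For a pure marginal this makes every extension a product `ρ ⊗ ω`, so `fQ` and `fR` are constantly
`S_A`, while `fP = S_A + S_V` is least when `V` is trivial.

For a marginal on the symmetric or antisymmetric subspace, take `K = F ∓ 1`: the swap acts on every
extension as a sign, so `S_AV = S_BV`. Then `fQ` is constantly `S_A`, and `fR` equals `S_AB / 2`
plus half the conditional mutual information. Weak monotonicity, `S_A + S_B ≤ S_AV + S_BV`, becomes
`S_A ≤ S_AV`, and the trivial extension attains equality. The class is closed under tensor products,
so additivity of `E_P` reduces to additivity of entropy. Classically correlated states are
symmetric, and copying the classical index into `V` shows that their squashed entanglement vanishes.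

Strong subadditivity is derived from monotonicity of relative entropy under partial trace. With
eigenvalues `p`, `q` and overlap weights `c`, the relative entropy `∑ c (log p - log q)` is the
total increase, apart from a `log t` term, of `∑ c log (t p + q)` over `t > 0`. The derivative `∑ c
p / (t p + q)` is the maximum over `K` of a quadratic form (`modularForm`); passing to marginals
restricts `K` to operators `K ⊗ 1`, so the derivative can only decrease. Weak monotonicity follows
by purification. -/

/-- `ρ = U diag(p) Uᴴ` for a unitary `U` (with columns indexed by any type) and `p ≥ 0`. -/
structure IsSpectral {X I : Type*} [Fintype X] [DecidableEq X] [Fintype I] [DecidableEq I]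
    (ρ : Matrix X X ℂ) (U : Matrix X I ℂ) (p : I → ℝ) : Prop where
  nonneg : ∀ i, 0 ≤ p i
  isometry : Uᴴ * U = 1
  coisometry : U * Uᴴ = 1
  eq : ρ = U * diagonal (fun i => (p i : ℂ)) * Uᴴ

/-! ### Entropy as a function of the spectrum -/

section Basic

variable {X Y I J : Type*} [Fintype X] [DecidableEq X] [Fintype Y] [DecidableEq Y]
  [Fintype I] [DecidableEq I] [Fintype J] [DecidableEq J]

theorem exists_isSpectral {ρ : Matrix X X ℂ} (h : ρ.PosSemidef) :
    ∃ (U : Matrix X X ℂ) (p : X → ℝ), IsSpectral ρ U p := by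
  refine ⟨h.1.eigenvectorUnitary, h.1.eigenvalues, h.eigenvalues_nonneg, ?_, ?_, ?_⟩
  · exact Unitary.coe_star_mul_self h.1.eigenvectorUnitary
  · exact Unitary.coe_mul_star_self h.1.eigenvectorUnitary
  · conv_lhs => rw [h.1.spectral_theorem, Unitary.conjStarAlgAut_apply]
    rfl

theorem exists_eq_mul_conjTranspose {ρ : Matrix X X ℂ} (h : ρ.PosSemidef) :
    ∃ R : Matrix X X ℂ, ρ = R * Rᴴ := by
  obtain ⟨U, p, hs⟩ := exists_isSpectral h
  refine ⟨U * diagonal (fun i => ((√(p i) : ℝ) : ℂ)), ?_⟩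
  rw [conjTranspose_mul, diagonal_conjTranspose, ← Matrix.mul_assoc, Matrix.mul_assoc U,
    diagonal_mul_diagonal, hs.eq]
  congr 3
  ext i
  simp only [Pi.star_apply, Complex.star_def, Complex.conj_ofReal, ← Complex.ofReal_mul,
    Real.mul_self_sqrt (hs.nonneg i)]

theorem entropy_eq_sum_eigenvalues {ρ : Matrix X X ℂ} (h : ρ.IsHermitian) :
    entropy ρ = ∑ i, Real.negMulLog (h.eigenvalues i) := by
  have e : ρ * cfc Real.log ρ = (h.eigenvectorUnitary : Matrix X X ℂ) *
      diagonal (fun i => ((h.eigenvalues i * Real.log (h.eigenvalues i) : ℝ) : ℂ)) *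
      (star h.eigenvectorUnitary : Matrix X X ℂ) := by
    rw [h.cfc_eq, Matrix.IsHermitian.cfc]
    conv_lhs => enter [1]; rw [h.spectral_theorem]
    rw [← map_mul, diagonal_mul_diagonal, Unitary.conjStarAlgAut_apply]
    simp
  rw [entropy, e, trace_mul_comm, ← Matrix.mul_assoc, Unitary.coe_star_mul_self, Matrix.one_mul,
    trace_diagonal, ← Complex.ofReal_sum, Complex.ofReal_re, ← Finset.sum_neg_distrib]
  simp [Real.negMulLog]

theorem entropy_eq_sum_roots {ρ : Matrix X X ℂ} (h : ρ.IsHermitian) :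
    entropy ρ = (ρ.charpoly.roots.map fun z : ℂ => Real.negMulLog z.re).sum := by
  rw [entropy_eq_sum_eigenvalues h, h.roots_charpoly_eq_eigenvalues, Multiset.map_map]
  rfl

/-- Zero eigenvalues contribute nothing, since `negMulLog 0 = 0`. The powers of `X` account for
them, so matrices of different sizes can be compared. -/
theorem entropy_eq_of_charpoly {ρ : Matrix X X ℂ} {σ : Matrix Y Y ℂ} (hρ : ρ.IsHermitian)
    (hσ : σ.IsHermitian) {m n : ℕ}
    (h : Polynomial.X ^ m * ρ.charpoly = Polynomial.X ^ n * σ.charpoly) :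
    entropy ρ = entropy σ := by
  have key : ∀ (k : ℕ) (q : Polynomial ℂ), q ≠ 0 →
      ((Polynomial.X ^ k * q).roots.map fun z : ℂ => Real.negMulLog z.re).sum =
        (q.roots.map fun z : ℂ => Real.negMulLog z.re).sum := by
    intro k q hq
    rw [Polynomial.roots_mul (mul_ne_zero (pow_ne_zero _ Polynomial.X_ne_zero) hq)]
    simp [Multiset.map_nsmul, Multiset.sum_nsmul]
  rw [entropy_eq_sum_roots hρ, entropy_eq_sum_roots hσ, ← key m _ ρ.charpoly_monic.ne_zero, h,
    key n _ σ.charpoly_monic.ne_zero]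

/-- This plays the role of the Schmidt decomposition: if `N` holds the amplitudes of a bipartite
pure state, the two sides are the entropies of its marginals, up to transposition. -/
theorem entropy_mul_conjTranspose (N : Matrix X Y ℂ) : entropy (N * Nᴴ) = entropy (Nᴴ * N) :=
  entropy_eq_of_charpoly (isHermitian_mul_conjTranspose_self N)
    (isHermitian_conjTranspose_mul_self N) (charpoly_mul_comm' N Nᴴ)

theorem entropy_transpose {ρ : Matrix X X ℂ} (h : ρ.IsHermitian) : entropy ρᵀ = entropy ρ :=
  entropy_eq_of_charpoly (m := 0) (n := 0) h.transpose h (by rw [charpoly_transpose])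

theorem entropy_submatrix_equiv {ρ : Matrix X X ℂ} (h : ρ.IsHermitian) (e : Y ≃ X) :
    entropy (ρ.submatrix e e) = entropy ρ :=
  entropy_eq_of_charpoly (m := 0) (n := 0) (h.submatrix e) h
    (by rw [← charpoly_reindex e.symm ρ]; rfl)

theorem entropy_diagonal (p : X → ℝ) :
    entropy (diagonal fun i => (p i : ℂ)) = ∑ i, Real.negMulLog (p i) := by
  rw [entropy_eq_sum_roots, charpoly_diagonal, Polynomial.roots_prod]
  · simp
  · simp [Finset.prod_ne_zero_iff, Polynomial.X_sub_C_ne_zero]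
  · rw [IsHermitian, diagonal_conjTranspose]
    congr 1
    ext i
    simp

theorem IsSpectral.isHermitian {ρ : Matrix X X ℂ} {U : Matrix X I ℂ} {p : I → ℝ}
    (h : IsSpectral ρ U p) : ρ.IsHermitian := by
  rw [h.eq, IsHermitian, conjTranspose_mul, conjTranspose_mul, diagonal_conjTranspose,
    conjTranspose_conjTranspose, Matrix.mul_assoc]
  congr 3
  ext i
  simp

theorem IsSpectral.conj {ρ : Matrix X X ℂ} {U : Matrix X I ℂ} {p : I → ℝ}
    (h : IsSpectral ρ U p) : Uᴴ * ρ * U = diagonal (fun i => (p i : ℂ)) := by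
  rw [h.eq, Matrix.mul_assoc U, ← Matrix.mul_assoc, h.isometry, Matrix.one_mul,
    Matrix.mul_assoc, h.isometry, Matrix.mul_one]

theorem IsSpectral.entropy_eq {ρ : Matrix X X ℂ} {U : Matrix X I ℂ} {p : I → ℝ}
    (h : IsSpectral ρ U p) : entropy ρ = ∑ i, Real.negMulLog (p i) := by
  rw [← entropy_diagonal]
  have h2 := charpoly_mul_comm' (U * diagonal (fun i => (p i : ℂ))) Uᴴ
  rw [← h.eq, ← Matrix.mul_assoc, h.isometry, Matrix.one_mul] at h2
  refine entropy_eq_of_charpoly h.isHermitian ?_ h2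
  rw [← h.conj]
  exact isHermitian_conjTranspose_mul_mul U h.isHermitian

theorem IsSpectral.trace_eq {ρ : Matrix X X ℂ} {U : Matrix X I ℂ} {p : I → ℝ}
    (h : IsSpectral ρ U p) : ρ.trace = ((∑ i, p i : ℝ) : ℂ) := by
  rw [h.eq, trace_mul_comm, ← Matrix.mul_assoc, h.isometry, Matrix.one_mul,
    trace_diagonal, Complex.ofReal_sum]

theorem IsSpectral.kronecker {ρ : Matrix X X ℂ} {U : Matrix X I ℂ} {p : I → ℝ}
    {σ : Matrix Y Y ℂ} {V : Matrix Y J ℂ} {q : J → ℝ}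
    (h : IsSpectral ρ U p) (h' : IsSpectral σ V q) :
    IsSpectral (ρ ⊗ₖ σ) (U ⊗ₖ V) (fun k => p k.1 * q k.2) where
  nonneg k := mul_nonneg (h.nonneg _) (h'.nonneg _)
  isometry := by
    rw [conjTranspose_kronecker, ← mul_kronecker_mul, h.isometry, h'.isometry,
      one_kronecker_one]
  coisometry := by
    rw [conjTranspose_kronecker, ← mul_kronecker_mul, h.coisometry, h'.coisometry,
      one_kronecker_one]
  eq := by
    have e : (diagonal fun k : I × J => ((p k.1 * q k.2 : ℝ) : ℂ)) =
        (diagonal fun i => (p i : ℂ)) ⊗ₖ (diagonal fun i => (q i : ℂ)) := by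
      rw [diagonal_kronecker_diagonal]
      simp
    rw [e, conjTranspose_kronecker, ← mul_kronecker_mul, ← mul_kronecker_mul, ← h.eq, ← h'.eq]

theorem IsState.entropy_nonneg {ρ : Matrix X X ℂ} (h : IsState ρ) : 0 ≤ entropy ρ := by
  obtain ⟨U, p, hs⟩ := exists_isSpectral h.posSemidef
  have h1 : ∑ i, p i = 1 := by
    have := hs.trace_eq
    rw [h.trace_eq_one] at this
    exact_mod_cast this.symm
  rw [hs.entropy_eq]
  exact Finset.sum_nonneg fun i _ => Real.negMulLog_nonneg (hs.nonneg i)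
    (h1 ▸ Finset.single_le_sum (fun j _ => hs.nonneg j) (Finset.mem_univ i))

theorem entropy_kronecker {ρ : Matrix X X ℂ} {σ : Matrix Y Y ℂ} (hρ : IsState ρ)
    (hσ : IsState σ) : entropy (ρ ⊗ₖ σ) = entropy ρ + entropy σ := by
  obtain ⟨U, p, hs⟩ := exists_isSpectral hρ.posSemidef
  obtain ⟨V, q, ht⟩ := exists_isSpectral hσ.posSemidef
  have h1 : ∑ i, p i = 1 := by
    have := hs.trace_eq
    rw [hρ.trace_eq_one] at this
    exact_mod_cast this.symm
  have h2 : ∑ i, q i = 1 := by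
    have := ht.trace_eq
    rw [hσ.trace_eq_one] at this
    exact_mod_cast this.symm
  rw [(hs.kronecker ht).entropy_eq, hs.entropy_eq, ht.entropy_eq, Fintype.sum_prod_type]
  simp only [Real.negMulLog_mul, Finset.sum_add_distrib, ← Finset.sum_mul, ← Finset.mul_sum, h1, h2,
    one_mul]

end Basic

/-! ### Partial traces of states -/

section PartialTrace

variable {X Y : Type*}

theorem posSemidef_trRight [Fintype Y] {ρ : Matrix (X × Y) (X × Y) ℂ} (h : ρ.PosSemidef) :
    (trRight ρ).PosSemidef := by
  have : trRight ρ = ∑ y, ρ.submatrix (fun x => (x, y)) (fun x => (x, y)) := by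
    ext x x'
    simp [trRight, Matrix.sum_apply]
  rw [this]
  exact posSemidef_sum _ fun y _ => h.submatrix _

theorem posSemidef_trLeft [Fintype X] {ρ : Matrix (X × Y) (X × Y) ℂ} (h : ρ.PosSemidef) :
    (trLeft ρ).PosSemidef := by
  have : trLeft ρ = ∑ x, ρ.submatrix (fun y => (x, y)) (fun y => (x, y)) := by
    ext x x'
    simp [trLeft, Matrix.sum_apply]
  rw [this]
  exact posSemidef_sum _ fun y _ => h.submatrix _

theorem trace_trRight [Fintype X] [Fintype Y] (ρ : Matrix (X × Y) (X × Y) ℂ) :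
    (trRight ρ).trace = ρ.trace := by
  simp [Matrix.trace, trRight, Fintype.sum_prod_type]

theorem trace_trLeft [Fintype X] [Fintype Y] (ρ : Matrix (X × Y) (X × Y) ℂ) :
    (trLeft ρ).trace = ρ.trace := by
  simp only [Matrix.trace, trLeft, diag_apply, of_apply, Fintype.sum_prod_type]
  exact Finset.sum_comm

theorem IsState.trRight [Fintype X] [Fintype Y] {ρ : Matrix (X × Y) (X × Y) ℂ} (h : IsState ρ) :
    IsState (trRight ρ) :=
  ⟨posSemidef_trRight h.posSemidef, by rw [trace_trRight, h.trace_eq_one]⟩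

theorem IsState.trLeft [Fintype X] [Fintype Y] {ρ : Matrix (X × Y) (X × Y) ℂ} (h : IsState ρ) :
    IsState (trLeft ρ) :=
  ⟨posSemidef_trLeft h.posSemidef, by rw [trace_trLeft, h.trace_eq_one]⟩

end PartialTrace

/-! ### Logarithms compared through their resolvents -/

section Scalar

theorem hasDerivAt_sum_mul_log {J : Type*} [Fintype J] {c p q : J → ℝ}
    (h : ∀ j, c j ≠ 0 → 0 < p j ∧ 0 < q j) {t : ℝ} (ht : 0 < t) :
    HasDerivAt (fun t => ∑ j, c j * Real.log (t * p j + q j))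
      (∑ j, c j * (p j / (t * p j + q j))) t := by
  refine HasDerivAt.fun_sum fun j _ => ?_
  by_cases hc : c j = 0
  · simpa [hc] using hasDerivAt_const t (0 : ℝ)
  · obtain ⟨hp, hq⟩ := h j hc
    have h1 : HasDerivAt (fun t => t * p j + q j) (p j) t := by
      simpa using ((hasDerivAt_id t).mul_const (p j)).add_const (q j)
    exact (h1.log (by positivity)).const_mul (c j)

theorem tendsto_sum_mul_log_zero {J : Type*} [Fintype J] {c p q : J → ℝ}
    (h : ∀ j, c j ≠ 0 → 0 < p j ∧ 0 < q j) :
    Tendsto (fun t => ∑ j, c j * Real.log (t * p j + q j)) (𝓝[>] 0)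
      (𝓝 (∑ j, c j * Real.log (q j))) := by
  refine tendsto_finsetSum _ fun j _ => ?_
  by_cases hc : c j = 0
  · simp [hc]
  · obtain ⟨hp, hq⟩ := h j hc
    have h1 : Tendsto (fun t => t * p j + q j) (𝓝[>] (0 : ℝ)) (𝓝 (q j)) := by
      have : ContinuousAt (fun t => t * p j + q j) (0 : ℝ) := by fun_prop
      simpa using this.tendsto.mono_left nhdsWithin_le_nhds
    exact (h1.log hq.ne').const_mul (c j)

theorem tendsto_sum_mul_log_atTop {J : Type*} [Fintype J] {c p q : J → ℝ}
    (h : ∀ j, c j ≠ 0 → 0 < p j ∧ 0 < q j) :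
    Tendsto (fun t => ∑ j, c j * Real.log (t * p j + q j) - (∑ j, c j) * Real.log t) atTop
      (𝓝 (∑ j, c j * Real.log (p j))) := by
  simp only [Finset.sum_mul, ← Finset.sum_sub_distrib]
  refine tendsto_finsetSum _ fun j _ => ?_
  by_cases hc : c j = 0
  · simp [hc]
  · obtain ⟨hp, hq⟩ := h j hc
    have h1 : Tendsto (fun t => p j + q j / t) atTop (𝓝 (p j)) := by
      simpa using tendsto_const_nhds.add (tendsto_id.const_div_atTop (q j))
    refine ((h1.log hp.ne').const_mul (c j)).congr' ?_
    filter_upwards [eventually_gt_atTop 0] with t ht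
    have : t * p j + q j = t * (p j + q j / t) := by field_simp
    rw [this, Real.log_mul ht.ne' (by positivity)]
    ring

/-- Let `G t` be the difference of the two sums of weighted `log (t p + q)`. The hypothesis `hle`
says that `G' ≥ 0`. The claim compares the limits of `G` at `0` and at infinity; the divergent `log
t` terms cancel because the total weights agree. No integral is needed. -/
theorem sum_mul_log_sub_log_le {J K : Type*} [Fintype J] [Fintype K] {c p q : J → ℝ}
    {c' p' q' : K → ℝ} (h : ∀ j, c j ≠ 0 → 0 < p j ∧ 0 < q j)
    (h' : ∀ j, c' j ≠ 0 → 0 < p' j ∧ 0 < q' j) (hsum : ∑ j, c' j = ∑ j, c j)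
    (hle : ∀ t : ℝ, 0 < t →
      ∑ j, c' j * (p' j / (t * p' j + q' j)) ≤ ∑ j, c j * (p j / (t * p j + q j))) :
    ∑ j, c' j * (Real.log (p' j) - Real.log (q' j)) ≤
      ∑ j, c j * (Real.log (p j) - Real.log (q j)) := by
  set G : ℝ → ℝ := fun t => ∑ j, c j * Real.log (t * p j + q j) -
    ∑ j, c' j * Real.log (t * p' j + q' j) with hG
  have hd : ∀ t, 0 < t → HasDerivAt G (∑ j, c j * (p j / (t * p j + q j)) -
      ∑ j, c' j * (p' j / (t * p' j + q' j))) t := fun t ht =>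
    (hasDerivAt_sum_mul_log h ht).sub (hasDerivAt_sum_mul_log h' ht)
  have hmono : MonotoneOn G (Set.Ioi 0) := by
    refine monotoneOn_of_deriv_nonneg (convex_Ioi 0)
      (fun t ht => (hd t ht).continuousAt.continuousWithinAt)
      (fun t ht => (hd t (interior_subset ht)).differentiableAt.differentiableWithinAt)
      fun t ht => ?_
    rw [(hd t (interior_subset ht)).deriv]
    exact sub_nonneg.2 (hle t (interior_subset ht))
  have h0 : Tendsto G (𝓝[>] 0) (𝓝 (∑ j, c j * Real.log (q j) - ∑ j, c' j * Real.log (q' j))) :=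
    (tendsto_sum_mul_log_zero h).sub (tendsto_sum_mul_log_zero h')
  have h1 : Tendsto G atTop (𝓝 (∑ j, c j * Real.log (p j) - ∑ j, c' j * Real.log (p' j))) := by
    refine ((tendsto_sum_mul_log_atTop h).sub (tendsto_sum_mul_log_atTop h')).congr fun t => ?_
    rw [hG, hsum]
    ring
  have hle1 : ∀ t, 0 < t → G t ≤ ∑ j, c j * Real.log (p j) - ∑ j, c' j * Real.log (p' j) := by
    intro t ht
    refine ge_of_tendsto h1 ?_
    filter_upwards [eventually_ge_atTop t] with s hs
    exact hmono ht (ht.trans_le hs) hs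
  have := le_of_tendsto h0 (eventually_mem_nhdsWithin.mono hle1)
  simp only [mul_sub, Finset.sum_sub_distrib]
  linarith

/-- Completing the square in `y`. For `d = 0` the convention `p / 0 = 0` is harmless, since `p`
vanishes as well. -/
theorem two_mul_re_sub_le (p d : ℝ) (c y : ℂ) (hd : 0 ≤ d) (h0 : d = 0 → p = 0) :
    2 * p * (c * y).re - d * Complex.normSq y ≤ Complex.normSq c * p * (p / d) := by
  rcases hd.eq_or_lt with hd | hd
  · simp [h0 hd.symm, ← hd]
  · have : Complex.normSq c * p * (p / d) - (2 * p * (c * y).re - d * Complex.normSq y) =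
        ((d * y.re - p * c.re) ^ 2 + (d * y.im + p * c.im) ^ 2) / d := by
      simp only [Complex.normSq_apply, Complex.mul_re]
      field_simp
      ring
    rw [← sub_nonneg, this]
    positivity

/-- The maximiser of the preceding quadratic is `y = star c * (p / d)`. -/
theorem two_mul_re_sub_eq (p d : ℝ) (c : ℂ) (h0 : d = 0 → p = 0) :
    2 * p * (c * (star c * ((p / d : ℝ) : ℂ))).re -
      d * Complex.normSq (star c * ((p / d : ℝ) : ℂ)) = Complex.normSq c * p * (p / d) := by
  by_cases hd : d = 0
  · simp [h0 hd, hd]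
  · simp only [Complex.normSq_apply, Complex.mul_re, Complex.mul_im, Complex.star_def,
      Complex.conj_re, Complex.conj_im, Complex.ofReal_re, Complex.ofReal_im]
    field_simp
    ring

end Scalar

/-! ### Variational formula for the relative modular operator -/

section Variational

variable {X I J : Type*} [Fintype X] [DecidableEq X] [Fintype I] [DecidableEq I]
  [Fintype J] [DecidableEq J]

/-- The concave quadratic functional whose supremum over `K` is the resolvent quantity
`⟨√ρ, (Δ + t)⁻¹ √ρ⟩` of the relative modular operator `Δ` of `(σ, ρ)`. -/
def modularForm (t : ℝ) (ρ σ K : Matrix X X ℂ) : ℝ :=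
  2 * (ρ * K).trace.re - t * (ρ * (Kᴴ * K)).trace.re - (σ * (K * Kᴴ)).trace.re

theorem trace_diagonal_mul_re (p : I → ℝ) (M : Matrix I I ℂ) :
    (diagonal (fun i => (p i : ℂ)) * M).trace.re = ∑ i, p i * (M i i).re := by
  simp [Matrix.trace, diagonal_mul]

theorem IsSpectral.trace_mul_re {ρ : Matrix X X ℂ} {U : Matrix X I ℂ} {p : I → ℝ}
    (h : IsSpectral ρ U p) (M : Matrix X X ℂ) :
    (ρ * M).trace.re = ∑ i, p i * ((Uᴴ * M * U) i i).re := by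
  rw [h.eq, Matrix.mul_assoc, Matrix.mul_assoc, trace_mul_comm, Matrix.mul_assoc,
    trace_diagonal_mul_re]

/-- In the two eigenbases the form decouples into one scalar quadratic for each pair of
eigenvectors, so it can be maximised entry by entry. -/
theorem modularForm_eq {ρ σ : Matrix X X ℂ} {U : Matrix X I ℂ} {p : I → ℝ} {V : Matrix X J ℂ}
    {q : J → ℝ} (hρ : IsSpectral ρ U p) (hσ : IsSpectral σ V q) (t : ℝ) (Y : Matrix J I ℂ) :
    modularForm t ρ σ (V * Y * Uᴴ) = ∑ i, ∑ j, (2 * p i * ((Uᴴ * V) i j * Y j i).re -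
      (t * p i + q j) * Complex.normSq (Y j i)) := by
  have e1 : Uᴴ * (V * Y * Uᴴ) * U = Uᴴ * V * Y := by
    rw [Matrix.mul_assoc, Matrix.mul_assoc (V * Y), hρ.isometry, Matrix.mul_one, Matrix.mul_assoc]
  have e2 : Uᴴ * ((V * Y * Uᴴ)ᴴ * (V * Y * Uᴴ)) * U = Yᴴ * Y := by
    have : (V * Y * Uᴴ)ᴴ * (V * Y * Uᴴ) = U * (Yᴴ * (Vᴴ * V) * Y) * Uᴴ := by
      simp only [conjTranspose_mul, conjTranspose_conjTranspose, Matrix.mul_assoc]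
    rw [this, hσ.isometry, Matrix.mul_one, Matrix.mul_assoc U, ← Matrix.mul_assoc, hρ.isometry,
      Matrix.one_mul, Matrix.mul_assoc, hρ.isometry, Matrix.mul_one]
  have e3 : Vᴴ * ((V * Y * Uᴴ) * (V * Y * Uᴴ)ᴴ) * V = Y * Yᴴ := by
    have : (V * Y * Uᴴ) * (V * Y * Uᴴ)ᴴ = V * (Y * (Uᴴ * U) * Yᴴ) * Vᴴ := by
      simp only [conjTranspose_mul, conjTranspose_conjTranspose, Matrix.mul_assoc]
    rw [this, hρ.isometry, Matrix.mul_one, Matrix.mul_assoc V, ← Matrix.mul_assoc, hσ.isometry,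
      Matrix.one_mul, Matrix.mul_assoc, hσ.isometry, Matrix.mul_one]
  rw [modularForm, hρ.trace_mul_re, hρ.trace_mul_re, hσ.trace_mul_re, e1, e2, e3]
  have f2 : ∀ i, ((Yᴴ * Y) i i).re = ∑ j, Complex.normSq (Y j i) := by
    intro i
    rw [Matrix.mul_apply, Complex.re_sum]
    refine Finset.sum_congr rfl fun j _ => ?_
    simp [Complex.normSq_apply, conjTranspose_apply]
  have f3 : ∀ j, ((Y * Yᴴ) j j).re = ∑ i, Complex.normSq (Y j i) := by
    intro j
    rw [Matrix.mul_apply, Complex.re_sum]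
    refine Finset.sum_congr rfl fun i _ => ?_
    simp [Complex.normSq_apply, conjTranspose_apply]
  have f1 : ∀ i, ((Uᴴ * V * Y) i i).re = ∑ j, ((Uᴴ * V) i j * Y j i).re := by
    intro i
    rw [Matrix.mul_apply, Complex.re_sum]
  simp only [f1, f2, f3, Finset.mul_sum]
  rw [Finset.sum_comm (f := fun j i => q j * Complex.normSq (Y j i))]
  simp only [← Finset.sum_sub_distrib]
  refine Finset.sum_congr rfl fun i _ => Finset.sum_congr rfl fun j _ => ?_
  ring

/-- The weight `|⟨uᵢ, vⱼ⟩|² pᵢ` of a pair of eigenvectors. -/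
def overlap (U : Matrix X I ℂ) (p : I → ℝ) (V : Matrix X J ℂ) (k : I × J) : ℝ :=
  Complex.normSq ((Uᴴ * V) k.1 k.2) * p k.1

theorem add_eq_zero_left_of_nonneg {t p q : ℝ} (ht : 0 < t) (hp : 0 ≤ p) (hq : 0 ≤ q)
    (h : t * p + q = 0) : p = 0 := by
  have : 0 ≤ t * p := by positivity
  have h2 : t * p = 0 := by linarith
  exact (mul_eq_zero.1 h2).resolve_left ht.ne'

theorem modularForm_le {ρ σ : Matrix X X ℂ} {U : Matrix X I ℂ} {p : I → ℝ} {V : Matrix X J ℂ}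
    {q : J → ℝ} (hρ : IsSpectral ρ U p) (hσ : IsSpectral σ V q) {t : ℝ} (ht : 0 < t)
    (K : Matrix X X ℂ) :
    modularForm t ρ σ K ≤ ∑ k, overlap U p V k * (p k.1 / (t * p k.1 + q k.2)) := by
  have hK : K = V * (Vᴴ * K * U) * Uᴴ := by
    rw [Matrix.mul_assoc V, Matrix.mul_assoc (Vᴴ * K), hρ.coisometry, Matrix.mul_one,
      ← Matrix.mul_assoc, hσ.coisometry, Matrix.one_mul]
  rw [hK, modularForm_eq hρ hσ, Fintype.sum_prod_type]
  refine Finset.sum_le_sum fun i _ => Finset.sum_le_sum fun j _ => ?_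
  exact two_mul_re_sub_le _ _ _ _
    (add_nonneg (mul_nonneg ht.le (hρ.nonneg i)) (hσ.nonneg j))
    (add_eq_zero_left_of_nonneg ht (hρ.nonneg i) (hσ.nonneg j))

theorem exists_modularForm_eq {ρ σ : Matrix X X ℂ} {U : Matrix X I ℂ} {p : I → ℝ}
    {V : Matrix X J ℂ} {q : J → ℝ} (hρ : IsSpectral ρ U p) (hσ : IsSpectral σ V q) {t : ℝ}
    (ht : 0 < t) :
    ∃ K, modularForm t ρ σ K = ∑ k, overlap U p V k * (p k.1 / (t * p k.1 + q k.2)) := by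
  refine ⟨V * (of fun j i => star ((Uᴴ * V) i j) * ((p i / (t * p i + q j) : ℝ) : ℂ)) * Uᴴ, ?_⟩
  rw [modularForm_eq hρ hσ, Fintype.sum_prod_type]
  refine Finset.sum_congr rfl fun i _ => Finset.sum_congr rfl fun j _ => ?_
  exact two_mul_re_sub_eq _ _ _ (add_eq_zero_left_of_nonneg ht (hρ.nonneg i) (hσ.nonneg j))

theorem sum_overlap_right {ρ σ : Matrix X X ℂ} {U : Matrix X I ℂ} {p : I → ℝ}
    {V : Matrix X J ℂ} {q : J → ℝ} (hρ : IsSpectral ρ U p) (hσ : IsSpectral σ V q) (i : I) :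
    ∑ j, overlap U p V (i, j) = p i := by
  have h : (Uᴴ * V) * (Uᴴ * V)ᴴ = 1 := by
    rw [conjTranspose_mul, conjTranspose_conjTranspose, Matrix.mul_assoc, ← Matrix.mul_assoc V,
      hσ.coisometry, Matrix.one_mul, hρ.isometry]
  have h2 : ∑ j, Complex.normSq ((Uᴴ * V) i j) = 1 := by
    have := congrArg Complex.re (congrFun (congrFun h i) i)
    rw [Matrix.mul_apply, Complex.re_sum] at this
    simpa [Complex.normSq_apply, conjTranspose_apply] using this
  simp only [overlap, ← Finset.sum_mul, h2, one_mul]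

/-- Unlike the sum over `j`, this one does not give the eigenvalues of the second operator, but the
diagonal of `ρ` in the basis `V`. -/
theorem sum_overlap_left {ρ : Matrix X X ℂ} {U : Matrix X I ℂ} {p : I → ℝ}
    {V : Matrix X J ℂ} (hρ : IsSpectral ρ U p) (j : J) :
    ∑ i, overlap U p V (i, j) = ((Vᴴ * ρ * V) j j).re := by
  have : Vᴴ * ρ * V = (Uᴴ * V)ᴴ * (diagonal (fun i => (p i : ℂ)) * (Uᴴ * V)) := by
    rw [hρ.eq, conjTranspose_mul, conjTranspose_conjTranspose]
    simp only [Matrix.mul_assoc]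
  rw [this, Matrix.mul_apply, Complex.re_sum]
  refine Finset.sum_congr rfl fun i _ => ?_
  rw [diagonal_mul, conjTranspose_apply, overlap]
  simp only [Complex.normSq_apply, Complex.mul_re, Complex.mul_im, Complex.star_def,
      Complex.conj_re, Complex.conj_im, Complex.ofReal_re, Complex.ofReal_im]
  ring

theorem IsSpectral.overlap_nonneg {ρ : Matrix X X ℂ} {U : Matrix X I ℂ} {p : I → ℝ}
    (hρ : IsSpectral ρ U p) (V : Matrix X J ℂ) (k : I × J) : 0 ≤ overlap U p V k :=
  mul_nonneg (Complex.normSq_nonneg _) (hρ.nonneg _)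

theorem IsSpectral.pos_of_overlap_ne_zero {ρ : Matrix X X ℂ} {U : Matrix X I ℂ} {p : I → ℝ}
    (hρ : IsSpectral ρ U p) {V : Matrix X J ℂ} {k : I × J} (h : overlap U p V k ≠ 0) :
    0 < p k.1 :=
  (hρ.nonneg _).lt_of_ne' (right_ne_zero_of_mul h)

end Variational

/-! ### Monotonicity of relative entropy under partial trace -/

section Monotone

variable {P Z : Type*} [Fintype P] [DecidableEq P] [Fintype Z] [DecidableEq Z]

theorem trace_trRight_mul (ρ : Matrix (P × Z) (P × Z) ℂ) (K : Matrix P P ℂ) :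
    (trRight ρ * K).trace = (ρ * (K ⊗ₖ (1 : Matrix Z Z ℂ))).trace := by
  simp only [Matrix.trace, diag_apply, Matrix.mul_apply, trRight, of_apply, Fintype.sum_prod_type,
    kroneckerMap_apply, Matrix.one_apply, Finset.sum_mul, mul_ite, mul_one, mul_zero,
    Finset.sum_ite_eq', Finset.mem_univ, if_true]
  exact Finset.sum_congr rfl fun x _ => Finset.sum_comm

theorem trace_trLeft_mul (ρ : Matrix (P × Z) (P × Z) ℂ) (K : Matrix Z Z ℂ) :
    (trLeft ρ * K).trace = (ρ * ((1 : Matrix P P ℂ) ⊗ₖ K)).trace := by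
  simp only [Matrix.trace, diag_apply, Matrix.mul_apply, trLeft, of_apply, Fintype.sum_prod_type,
    kroneckerMap_apply, Matrix.one_apply, Finset.sum_mul, mul_ite, mul_zero, ite_mul,
    one_mul, zero_mul]
  refine (Finset.sum_congr rfl fun z _ => Finset.sum_comm).trans ?_
  rw [Finset.sum_comm]
  refine Finset.sum_congr rfl fun x _ => Finset.sum_congr rfl fun z _ => ?_
  rw [Finset.sum_comm]
  simp

/-- Since `K ↦ K ⊗ 1` preserves products and adjoints, the variational problem of the marginals is
that of the global operators restricted to such `K ⊗ 1`. -/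
theorem modularForm_trRight (t : ℝ) (ρ σ : Matrix (P × Z) (P × Z) ℂ) (K : Matrix P P ℂ) :
    modularForm t (trRight ρ) (trRight σ) K =
      modularForm t ρ σ (K ⊗ₖ (1 : Matrix Z Z ℂ)) := by
  simp only [modularForm, trace_trRight_mul, conjTranspose_kronecker, conjTranspose_one,
    ← mul_kronecker_mul, Matrix.one_mul]

/-- Monotonicity of the relative entropy under a partial trace. -/
theorem relEntropy_trRight_le {I J I' J' : Type*} [Fintype I] [DecidableEq I] [Fintype J]
    [DecidableEq J] [Fintype I'] [DecidableEq I'] [Fintype J'] [DecidableEq J']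
    {ρ σ : Matrix (P × Z) (P × Z) ℂ} {U : Matrix (P × Z) I ℂ} {p : I → ℝ}
    {V : Matrix (P × Z) J ℂ} {q : J → ℝ} {U' : Matrix P I' ℂ} {p' : I' → ℝ}
    {V' : Matrix P J' ℂ} {q' : J' → ℝ} (hρ : IsSpectral ρ U p) (hσ : IsSpectral σ V q)
    (hρ' : IsSpectral (trRight ρ) U' p') (hσ' : IsSpectral (trRight σ) V' q')
    -- The conditions `h` and `h'` say that the support of the first operator lies in that of the
    -- second, so that the relative entropy is finite.
    (h : ∀ k, overlap U p V k ≠ 0 → 0 < q k.2)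
    (h' : ∀ k, overlap U' p' V' k ≠ 0 → 0 < q' k.2) :
    ∑ k, overlap U' p' V' k * (Real.log (p' k.1) - Real.log (q' k.2)) ≤
      ∑ k, overlap U p V k * (Real.log (p k.1) - Real.log (q k.2)) := by
  refine sum_mul_log_sub_log_le (p := fun k => p k.1) (q := fun k => q k.2)
    (p' := fun k => p' k.1) (q' := fun k => q' k.2)
    (fun k hk => ⟨hρ.pos_of_overlap_ne_zero hk, h k hk⟩)
    (fun k hk => ⟨hρ'.pos_of_overlap_ne_zero hk, h' k hk⟩) ?_ fun t ht => ?_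
  · rw [Fintype.sum_prod_type, Fintype.sum_prod_type]
    simp only [sum_overlap_right hρ hσ, sum_overlap_right hρ' hσ']
    have := trace_trRight ρ
    rw [hρ.trace_eq, hρ'.trace_eq] at this
    exact_mod_cast this
  -- The optimal `K` for the marginals yields the competitor `K ⊗ 1` for the global problem.
  · obtain ⟨K, hK⟩ := exists_modularForm_eq hρ' hσ' ht
    rw [← hK, modularForm_trRight]
    exact modularForm_le hρ hσ ht _

end Monotone

/-! ### Mutual information as a relative entropy -/

section MutualInfo

variable {X Y Z : Type*} [Fintype X] [DecidableEq X] [Fintype Y] [DecidableEq Y]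
  [Fintype Z] [DecidableEq Z]

theorem IsSpectral.sum_mul_eq {I : Type*} [Fintype I] [DecidableEq I] {ρ : Matrix X X ℂ}
    {U : Matrix X I ℂ} {p : I → ℝ} (h : IsSpectral ρ U p) (g : I → ℝ) :
    ∑ i, p i * g i = (ρ * (U * diagonal (fun i => (g i : ℂ)) * Uᴴ)).trace.re := by
  rw [h.trace_mul_re, ← Matrix.mul_assoc, ← Matrix.mul_assoc, h.isometry, Matrix.one_mul,
    Matrix.mul_assoc, h.isometry, Matrix.mul_one]
  simp

theorem trace_mul_conj_diagonal_re {I : Type*} [Fintype I] [DecidableEq I] (ρ : Matrix X X ℂ)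
    (V : Matrix X I ℂ) (g : I → ℝ) :
    (ρ * (V * diagonal (fun i => (g i : ℂ)) * Vᴴ)).trace.re =
      ∑ i, ((Vᴴ * ρ * V) i i).re * g i := by
  rw [← Matrix.mul_assoc, ← Matrix.mul_assoc, trace_mul_comm, ← Matrix.mul_assoc,
    ← Matrix.mul_assoc, trace_mul_comm, trace_diagonal_mul_re]
  exact Finset.sum_congr rfl fun i _ => mul_comm _ _

section Product

variable {I K L : Type*} [Fintype I] [DecidableEq I] [Fintype K] [DecidableEq K] [Fintype L]
  [DecidableEq L] {ρ : Matrix (X × Y) (X × Y) ℂ} {U : Matrix (X × Y) I ℂ} {p : I → ℝ}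
  {V : Matrix X K ℂ} {a : K → ℝ} {W : Matrix Y L ℂ} {b : L → ℝ}

theorem sum_overlap_kronecker_fst (hρ : IsSpectral ρ U p) (hX : IsSpectral (trRight ρ) V a)
    (hY : IsSpectral (trLeft ρ) W b) (g : K → ℝ) :
    ∑ k, overlap U p (V ⊗ₖ W) k * g k.2.1 = ∑ i, a i * g i := by
  rw [hX.sum_mul_eq, trace_trRight_mul]
  have : (V * diagonal (fun i => (g i : ℂ)) * Vᴴ) ⊗ₖ (1 : Matrix Y Y ℂ) =
      (V ⊗ₖ W) * diagonal (fun k : K × L => ((g k.1 : ℝ) : ℂ)) * (V ⊗ₖ W)ᴴ := by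
    have e : diagonal (fun k : K × L => ((g k.1 : ℝ) : ℂ)) =
        diagonal (fun i => (g i : ℂ)) ⊗ₖ (1 : Matrix L L ℂ) := by
      rw [← diagonal_one, diagonal_kronecker_diagonal]
      simp
    rw [e, conjTranspose_kronecker, ← mul_kronecker_mul, ← mul_kronecker_mul, Matrix.mul_one,
      hY.coisometry]
  rw [this, trace_mul_conj_diagonal_re, Fintype.sum_prod_type_right]
  simp only [← Finset.sum_mul, sum_overlap_left hρ]

theorem sum_overlap_kronecker_snd (hρ : IsSpectral ρ U p) (hX : IsSpectral (trRight ρ) V a)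
    (hY : IsSpectral (trLeft ρ) W b) (g : L → ℝ) :
    ∑ k, overlap U p (V ⊗ₖ W) k * g k.2.2 = ∑ i, b i * g i := by
  rw [hY.sum_mul_eq, trace_trLeft_mul]
  have : (1 : Matrix X X ℂ) ⊗ₖ (W * diagonal (fun i => (g i : ℂ)) * Wᴴ) =
      (V ⊗ₖ W) * diagonal (fun k : K × L => ((g k.2 : ℝ) : ℂ)) * (V ⊗ₖ W)ᴴ := by
    have e : diagonal (fun k : K × L => ((g k.2 : ℝ) : ℂ)) =
        (1 : Matrix K K ℂ) ⊗ₖ diagonal (fun i => (g i : ℂ)) := by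
      rw [← diagonal_one, diagonal_kronecker_diagonal]
      simp
    rw [e, conjTranspose_kronecker, ← mul_kronecker_mul, ← mul_kronecker_mul, Matrix.mul_one,
      hX.coisometry]
  rw [this, trace_mul_conj_diagonal_re, Fintype.sum_prod_type_right]
  simp only [← Finset.sum_mul, sum_overlap_left hρ]

/-- The support of `ρ` lies in that of the product of its marginals: summing the weights against the
indicator of one eigenvector index returns the marginal eigenvalue, which is therefore positive as
soon as one weight is. -/
theorem pos_of_overlap_kronecker_ne_zero (hρ : IsSpectral ρ U p)
    (hX : IsSpectral (trRight ρ) V a) (hY : IsSpectral (trLeft ρ) W b) {k : I × (K × L)}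
    (hk : overlap U p (V ⊗ₖ W) k ≠ 0) : 0 < a k.2.1 ∧ 0 < b k.2.2 := by
  have hpos : 0 < overlap U p (V ⊗ₖ W) k := (hρ.overlap_nonneg _ k).lt_of_ne' hk
  constructor
  · have h := sum_overlap_kronecker_fst hρ hX hY (Pi.single k.2.1 1)
    have h2 : 0 < ∑ l, overlap U p (V ⊗ₖ W) l * (Pi.single k.2.1 1 : K → ℝ) l.2.1 := by
      refine Finset.sum_pos' (fun l _ => mul_nonneg (hρ.overlap_nonneg _ l) ?_)
        ⟨k, Finset.mem_univ _, by simpa using hpos⟩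
      rw [Pi.single_apply]
      split_ifs <;> norm_num
    rw [h] at h2
    simpa [Pi.single_apply] using h2
  · have h := sum_overlap_kronecker_snd hρ hX hY (Pi.single k.2.2 1)
    have h2 : 0 < ∑ l, overlap U p (V ⊗ₖ W) l * (Pi.single k.2.2 1 : L → ℝ) l.2.2 := by
      refine Finset.sum_pos' (fun l _ => mul_nonneg (hρ.overlap_nonneg _ l) ?_)
        ⟨k, Finset.mem_univ _, by simpa using hpos⟩
      rw [Pi.single_apply]
      split_ifs <;> norm_num
    rw [h] at h2
    simpa [Pi.single_apply] using h2

/-- The mutual information is the relative entropy to the product of the marginals. -/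
theorem mutualInfo_eq_relEntropy (hρ : IsSpectral ρ U p) (hX : IsSpectral (trRight ρ) V a)
    (hY : IsSpectral (trLeft ρ) W b) :
    mutualInfo ρ = ∑ k, overlap U p (V ⊗ₖ W) k *
      (Real.log (p k.1) - Real.log (a k.2.1 * b k.2.2)) := by
  have h1 : ∀ k, overlap U p (V ⊗ₖ W) k * (Real.log (p k.1) - Real.log (a k.2.1 * b k.2.2)) =
      overlap U p (V ⊗ₖ W) k * Real.log (p k.1) - overlap U p (V ⊗ₖ W) k * Real.log (a k.2.1) -
        overlap U p (V ⊗ₖ W) k * Real.log (b k.2.2) := by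
    intro k
    by_cases hk : overlap U p (V ⊗ₖ W) k = 0
    · simp [hk]
    · obtain ⟨h1, h2⟩ := pos_of_overlap_kronecker_ne_zero hρ hX hY hk
      rw [Real.log_mul h1.ne' h2.ne']
      ring
  have h2 : ∑ k, overlap U p (V ⊗ₖ W) k * Real.log (p k.1) = ∑ i, p i * Real.log (p i) := by
    rw [Fintype.sum_prod_type]
    simp only [← Finset.sum_mul, sum_overlap_right hρ (hX.kronecker hY)]
  simp only [h1, Finset.sum_sub_distrib]
  rw [h2, sum_overlap_kronecker_fst hρ hX hY fun k => Real.log (a k),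
    sum_overlap_kronecker_snd hρ hX hY fun k => Real.log (b k), mutualInfo, hρ.entropy_eq,
    hX.entropy_eq, hY.entropy_eq]
  simp only [Real.negMulLog, neg_mul, Finset.sum_neg_distrib]
  ring

end Product

theorem IsSpectral.submatrix {I : Type*} [Fintype I] [DecidableEq I] {ρ : Matrix X X ℂ}
    {U : Matrix X I ℂ} {p : I → ℝ} (h : IsSpectral ρ U p) (e : Y ≃ X) :
    IsSpectral (ρ.submatrix e e) (U.submatrix e id) p where
  nonneg := h.nonneg
  isometry := by
    rw [conjTranspose_submatrix, submatrix_mul_equiv, h.isometry, submatrix_id_id]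
  coisometry := by
    rw [conjTranspose_submatrix, ← submatrix_mul _ _ _ _ _ Function.bijective_id, h.coisometry,
      submatrix_one_equiv]
  eq := by
    rw [conjTranspose_submatrix, h.eq, submatrix_mul _ _ _ id _ Function.bijective_id,
      submatrix_mul _ _ _ id _ Function.bijective_id, submatrix_id_id]

theorem overlap_submatrix {I J : Type*} (U : Matrix X I ℂ) (p : I → ℝ) (V : Matrix X J ℂ)
    (e : Y ≃ X) : overlap (U.submatrix e id) p (V.submatrix e id) = overlap U p V := by
  ext k
  rw [overlap, conjTranspose_submatrix, submatrix_mul_equiv, submatrix_id_id, overlap]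

/-- Discarding part of a subsystem does not increase the mutual information. -/
theorem mutualInfo_trRight_le {ρ : Matrix (X × (Y × Z)) (X × (Y × Z)) ℂ} (h : ρ.PosSemidef) :
    mutualInfo (trRight (ρ.submatrix (Equiv.prodAssoc X Y Z) (Equiv.prodAssoc X Y Z))) ≤
      mutualInfo ρ := by
  set e := Equiv.prodAssoc X Y Z
  have h' : (trRight (ρ.submatrix e e)).PosSemidef := posSemidef_trRight (h.submatrix e)
  obtain ⟨U, p, hρ⟩ := exists_isSpectral h
  obtain ⟨V, a, hX⟩ := exists_isSpectral (posSemidef_trRight h)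
  obtain ⟨W, b, hY⟩ := exists_isSpectral (posSemidef_trLeft h)
  obtain ⟨U', p', hρ'⟩ := exists_isSpectral h'
  obtain ⟨V', a', hX'⟩ := exists_isSpectral (posSemidef_trRight h')
  obtain ⟨W', b', hY'⟩ := exists_isSpectral (posSemidef_trLeft h')
  rw [mutualInfo_eq_relEntropy hρ hX hY, mutualInfo_eq_relEntropy hρ' hX' hY']
  -- Discarding `Z` sends the product of the marginals to the product of the reduced marginals, so
  -- monotonicity compares exactly the two mutual informations.
  have hσ : trRight ((trRight ρ ⊗ₖ trLeft ρ).submatrix e e) =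
      trRight (trRight (ρ.submatrix e e)) ⊗ₖ trLeft (trRight (ρ.submatrix e e)) := by
    ext x x'
    simp only [trRight, trLeft, of_apply, submatrix_apply, kroneckerMap_apply, e,
      Equiv.prodAssoc_apply, Fintype.sum_prod_type]
    rw [← Finset.mul_sum]
    congr 1
    exact Finset.sum_comm
  have hmono := relEntropy_trRight_le (hρ.submatrix e) ((hX.kronecker hY).submatrix e) hρ'
    (hσ ▸ hX'.kronecker hY') (fun k hk => ?_) fun k hk => ?_
  · rwa [overlap_submatrix] at hmono
  · rw [overlap_submatrix] at hk
    obtain ⟨h1, h2⟩ := pos_of_overlap_kronecker_ne_zero hρ hX hY hk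
    exact mul_pos h1 h2
  · obtain ⟨h1, h2⟩ := pos_of_overlap_kronecker_ne_zero hρ' hX' hY' hk
    exact mul_pos h1 h2

end MutualInfo

/-! ### Strong subadditivity and weak monotonicity -/

section StrongSubadditivity

variable {A B V : Type*} [Fintype A] [DecidableEq A] [Fintype B] [DecidableEq B]
  [Fintype V] [DecidableEq V]

theorem posSemidef_margAV {σ : Matrix ((A × B) × V) ((A × B) × V) ℂ} (h : σ.PosSemidef) :
    (margAV σ).PosSemidef := by
  have : margAV σ = ∑ b, σ.submatrix (fun x : A × V => ((x.1, b), x.2)) fun x => ((x.1, b), x.2) := by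
    ext x x'
    simp [margAV, Matrix.sum_apply]
  rw [this]
  exact posSemidef_sum _ fun y _ => h.submatrix _

theorem posSemidef_margBV {σ : Matrix ((A × B) × V) ((A × B) × V) ℂ} (h : σ.PosSemidef) :
    (margBV σ).PosSemidef := by
  have : margBV σ = ∑ a, σ.submatrix (fun x : B × V => ((a, x.1), x.2)) fun x => ((a, x.1), x.2) := by
    ext x x'
    simp [margBV, Matrix.sum_apply]
  rw [this]
  exact posSemidef_sum _ fun y _ => h.submatrix _

/-- Strong subadditivity of the von Neumann entropy. -/
theorem condMutualInfo_nonneg {σ : Matrix ((A × B) × V) ((A × B) × V) ℂ} (h : σ.PosSemidef) :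
    0 ≤ condMutualInfo σ := by
  -- Regroup as `A` against `VB` and discard `B`: after `S_A` cancels, `I_{A:V} ≤ I_{A:VB}` is the
  -- claim.
  let e : A × (V × B) ≃ (A × B) × V :=
    ((Equiv.refl A).prodCongr (Equiv.prodComm V B)).trans (Equiv.prodAssoc A B V).symm
  have key := mutualInfo_trRight_le (h.submatrix e)
  have e1 : trRight ((σ.submatrix e e).submatrix (Equiv.prodAssoc A V B) (Equiv.prodAssoc A V B)) =
      margAV σ := by
    ext x x'
    simp [trRight, margAV, e]
  have e2 : trRight (margAV σ) = trRight (σ.submatrix e e) := by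
    ext x x'
    simp [trRight, margAV, e, Fintype.sum_prod_type]
  have e3 : trLeft (margAV σ) = trLeft σ := by
    ext x x'
    simp [trLeft, margAV, Fintype.sum_prod_type]
  have e4 : trLeft (σ.submatrix e e) =
      (margBV σ).submatrix (Equiv.prodComm V B) (Equiv.prodComm V B) := by
    ext x x'
    simp [trLeft, margBV, e]
  rw [e1, mutualInfo, mutualInfo, e2, e3, e4, entropy_submatrix_equiv (posSemidef_margBV h).1,
    entropy_submatrix_equiv h.1] at key
  rw [condMutualInfo]
  linarith

/-- Weak monotonicity, the form of strong subadditivity dual under purification. -/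
theorem entropy_add_entropy_le {σ : Matrix ((A × B) × V) ((A × B) × V) ℂ} (h : σ.PosSemidef) :
    entropy (trRight (trRight σ)) + entropy (trLeft (trRight σ)) ≤
      entropy (margAV σ) + entropy (margBV σ) := by
  obtain ⟨R, hR⟩ := exists_eq_mul_conjTranspose h
  -- The entries of `R` are the amplitudes of a purification of `σ` with environment `C` (the column
  -- index). `N` groups them as `VCA` against `B`, and `M` as `CA` against `BV`. Strong
  -- subadditivity for the state on `VCA`, conditioned on `A`, involves `S_CA` and `S_VCA`, which
  -- equal `S_BV` and `S_B` by purity.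
  let N : Matrix ((V × ((A × B) × V)) × A) B ℂ := of fun x b => R ((x.2, b), x.1.1) x.1.2
  let M : Matrix (((A × B) × V) × A) (B × V) ℂ := of fun x y => R ((x.2, y.1), y.2) x.1
  have key := condMutualInfo_nonneg (posSemidef_self_mul_conjTranspose N)
  have e1 : margAV (N * Nᴴ) =
      (margAV σ).submatrix (Equiv.prodComm V A) (Equiv.prodComm V A) := by
    ext x x'
    simp only [margAV, of_apply, submatrix_apply, hR, Matrix.mul_apply, N, conjTranspose_apply,
      Equiv.prodComm_apply, Prod.fst_swap, Prod.snd_swap]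
    exact Finset.sum_comm
  have e2 : margBV (N * Nᴴ) = M * Mᴴ := by
    ext x x'
    simp only [margBV, of_apply, Matrix.mul_apply, N, M, conjTranspose_apply,
      Fintype.sum_prod_type_right (f := fun x : B × V => _)]
  have e3 : Mᴴ * M = (margBV σ)ᵀ := by
    ext x x'
    simp only [margBV, of_apply, Matrix.mul_apply, M, conjTranspose_apply, hR, transpose_apply]
    rw [Fintype.sum_prod_type_right]
    simp only [mul_comm]
  have e4 : Nᴴ * N = (trLeft (trRight σ))ᵀ := by
    ext x x'
    simp only [trLeft, trRight, of_apply, Matrix.mul_apply, N, conjTranspose_apply, hR,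
      transpose_apply]
    rw [Fintype.sum_prod_type_right]
    refine Finset.sum_congr rfl fun a _ => ?_
    rw [Fintype.sum_prod_type]
    simp only [mul_comm]
  have e5 : trLeft (N * Nᴴ) = trRight (trRight σ) := by
    ext x x'
    simp only [trLeft, trRight, of_apply, Matrix.mul_apply, N, conjTranspose_apply, hR]
    rw [Finset.sum_comm]
    refine Finset.sum_congr rfl fun b _ => ?_
    rw [Fintype.sum_prod_type]
  rw [condMutualInfo, e1, e2, e5, entropy_mul_conjTranspose M, entropy_mul_conjTranspose N, e3, e4,
    entropy_transpose (posSemidef_margBV h).1,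
    entropy_transpose (posSemidef_trLeft (posSemidef_trRight h)).1,
    entropy_submatrix_equiv (posSemidef_margAV h).1] at key
  linarith

end StrongSubadditivity

/-! ### Support of a positive operator and of its marginal -/

section Support

variable {P Q Z : Type*} [Fintype P] [DecidableEq P] [Fintype Q] [DecidableEq Q] [Fintype Z]
  [DecidableEq Z]

theorem sub_kronecker (K L : Matrix Q P ℂ) (M : Matrix Z Z ℂ) :
    (K - L) ⊗ₖ M = K ⊗ₖ M - L ⊗ₖ M := by
  ext x y
  simp [sub_mul]

/-- An operator annihilating the marginal of a positive operator annihilates the operator. -/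
theorem kronecker_one_mul_eq_zero {σ : Matrix (P × Z) (P × Z) ℂ} (h : σ.PosSemidef)
    {K : Matrix Q P ℂ} (hK : K * trRight σ = 0) : (K ⊗ₖ (1 : Matrix Z Z ℂ)) * σ = 0 := by
  obtain ⟨R, hR⟩ := exists_eq_mul_conjTranspose h
  have hT : (K ⊗ₖ (1 : Matrix Z Z ℂ)) * R = 0 := by
    -- The squared Hilbert–Schmidt norm of `(K ⊗ 1) R` depends on the marginal alone: it is the
    -- trace of `K * trRight σ * Kᴴ`.
    rw [← trace_mul_conjTranspose_self_eq_zero_iff]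
    have : (K ⊗ₖ (1 : Matrix Z Z ℂ)) * R * ((K ⊗ₖ (1 : Matrix Z Z ℂ)) * R)ᴴ =
        (K ⊗ₖ (1 : Matrix Z Z ℂ)) * (σ * (Kᴴ ⊗ₖ (1 : Matrix Z Z ℂ))) := by
      rw [hR, conjTranspose_mul, conjTranspose_kronecker, conjTranspose_one]
      simp only [Matrix.mul_assoc]
    rw [this, trace_mul_comm, Matrix.mul_assoc, ← mul_kronecker_mul, Matrix.one_mul,
      ← trace_trRight_mul, ← Matrix.mul_assoc, trace_mul_comm, ← Matrix.mul_assoc, hK]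
    simp
  rw [hR, ← Matrix.mul_assoc, hT, Matrix.zero_mul]

end Support

/-! ### Pure states and product states -/

section States

variable {X Y : Type*} [Fintype X] [DecidableEq X] [Fintype Y] [DecidableEq Y]

theorem IsState.kronecker {ρ : Matrix X X ℂ} {σ : Matrix Y Y ℂ} (hρ : IsState ρ)
    (hσ : IsState σ) : IsState (ρ ⊗ₖ σ) :=
  ⟨hρ.posSemidef.kronecker hσ.posSemidef, by
    rw [trace_kronecker, hρ.trace_eq_one, hσ.trace_eq_one, mul_one]⟩

theorem isState_one : IsState (1 : Matrix (Fin 1) (Fin 1) ℂ) :=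
  ⟨PosSemidef.one, by simp⟩

theorem entropy_one : entropy (1 : Matrix (Fin 1) (Fin 1) ℂ) = 0 := by
  have := entropy_diagonal (fun _ : Fin 1 => (1 : ℝ))
  simpa using this

theorem trace_pureOp {ψ : X → ℂ} (h : ∑ x, ‖ψ x‖ ^ 2 = 1) : (pureOp ψ).trace = 1 := by
  have h2 : ((∑ x, ‖ψ x‖ ^ 2 : ℝ) : ℂ) = 1 := by rw [h]; simp
  rw [← h2]
  simp [pureOp, Matrix.trace, vecMulVec_apply, Complex.mul_conj, Complex.normSq_eq_norm_sq]

theorem posSemidef_pureOp (ψ : X → ℂ) : (pureOp ψ).PosSemidef :=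
  posSemidef_vecMulVec_self_star ψ

theorem isState_pureOp {ψ : X → ℂ} (h : ∑ x, ‖ψ x‖ ^ 2 = 1) : IsState (pureOp ψ) :=
  ⟨posSemidef_pureOp ψ, trace_pureOp h⟩

theorem entropy_pureOp {ψ : X → ℂ} (h : ∑ x, ‖ψ x‖ ^ 2 = 1) : entropy (pureOp ψ) = 0 := by
  let N : Matrix X (Fin 1) ℂ := of fun x _ => ψ x
  have e1 : pureOp ψ = N * Nᴴ := by
    ext x y
    simp [pureOp, N, vecMulVec_apply, Matrix.mul_apply]
  have e2 : Nᴴ * N = 1 := by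
    ext i j
    have := trace_pureOp h
    rw [e1, trace_mul_comm] at this
    rw [Subsingleton.elim i 0, Subsingleton.elim j 0, one_apply_eq]
    simpa [Matrix.trace] using this
  rw [e1, entropy_mul_conjTranspose, e2, entropy_one]

theorem pureOp_mul_self {ψ : X → ℂ} (h : ∑ x, ‖ψ x‖ ^ 2 = 1) :
    pureOp ψ * pureOp ψ = pureOp ψ := by
  have h1 : star ψ ⬝ᵥ ψ = 1 := by
    rw [← trace_pureOp h, pureOp, trace_vecMulVec, dotProduct_comm]
  rw [pureOp, vecMulVec_mul_vecMulVec, h1, one_smul]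

theorem entropy_trRight_pureOp (ψ : X × Y → ℂ) :
    entropy (trRight (pureOp ψ)) = entropy (trLeft (pureOp ψ)) := by
  let N : Matrix X Y ℂ := of fun x y => ψ (x, y)
  have e1 : trRight (pureOp ψ) = N * Nᴴ := by
    ext x y
    simp [trRight, pureOp, N, vecMulVec_apply, Matrix.mul_apply]
  have e2 : Nᴴ * N = (trLeft (pureOp ψ))ᵀ := by
    ext x y
    simp [trLeft, pureOp, N, vecMulVec_apply, Matrix.mul_apply, mul_comm]
  rw [e1, entropy_mul_conjTranspose, e2,
    entropy_transpose (posSemidef_trLeft (posSemidef_pureOp ψ)).1]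

/-- A state with a pure marginal is a product state. -/
theorem eq_kronecker_of_trRight_eq_pureOp {ψ : X → ℂ} (h : ∑ x, ‖ψ x‖ ^ 2 = 1)
    {σ : Matrix (X × Y) (X × Y) ℂ} (hσ : σ.PosSemidef) (hψ : trRight σ = pureOp ψ) :
    σ = pureOp ψ ⊗ₖ trLeft σ := by
  -- The projection `1 - pureOp ψ` annihilates the marginal, so `σ` is unchanged by compression with
  -- `pureOp ψ ⊗ 1` on both sides.
  have h1 : (pureOp ψ ⊗ₖ (1 : Matrix Y Y ℂ)) * σ = σ := by
    have hK : (1 - pureOp ψ) * trRight σ = 0 := by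
      rw [hψ, Matrix.sub_mul, Matrix.one_mul, pureOp_mul_self h, sub_self]
    have h0 := kronecker_one_mul_eq_zero hσ hK
    have e : (1 - pureOp ψ) ⊗ₖ (1 : Matrix Y Y ℂ) = 1 - pureOp ψ ⊗ₖ (1 : Matrix Y Y ℂ) := by
      rw [sub_kronecker, one_kronecker_one]
    rw [e, Matrix.sub_mul, Matrix.one_mul, sub_eq_zero] at h0
    exact h0.symm
  have h2 : σ * (pureOp ψ ⊗ₖ (1 : Matrix Y Y ℂ)) = σ := by
    have := congrArg conjTranspose h1
    rwa [conjTranspose_mul, conjTranspose_kronecker, conjTranspose_one,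
      (isState_pureOp h).posSemidef.1.eq, hσ.1.eq] at this
  -- The partial matrix element `⟨ψ|σ|ψ⟩`, which turns out to be the marginal on `Y`.
  let ω : Matrix Y Y ℂ := of fun v w => ∑ y, ∑ x, star (ψ x) * σ (x, v) (y, w) * ψ y
  have h3 : σ = pureOp ψ ⊗ₖ ω := by
    conv_lhs => rw [← h2, ← h1]
    ext ⟨x, v⟩ ⟨y, w⟩
    simp only [Matrix.mul_apply, Fintype.sum_prod_type, kroneckerMap_apply, Matrix.one_apply,
      mul_ite, mul_one, mul_zero, ite_mul, zero_mul, Finset.sum_ite_eq, Finset.sum_ite_eq',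
      Finset.mem_univ, if_true, pureOp, vecMulVec_apply, Pi.star_apply, ω, of_apply,
      Finset.mul_sum, Finset.sum_mul]
    refine Finset.sum_congr rfl fun y' _ => Finset.sum_congr rfl fun x' _ => ?_
    ring
  have h4 : trLeft σ = ω := by
    rw [h3]
    ext v w
    simp only [trLeft, of_apply, kroneckerMap_apply, ← Finset.sum_mul]
    have := trace_pureOp h
    simp only [Matrix.trace, diag_apply] at this
    rw [this, one_mul]
  rw [h4]
  exact h3

end States

/-! ### Extensions and infima over them -/

section Extensions

variable {A B V : Type*} [Fintype A] [DecidableEq A] [Fintype B] [DecidableEq B]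
  [Fintype V] [DecidableEq V]

theorem margAV_kronecker (ρ : Matrix (A × B) (A × B) ℂ) (ω : Matrix V V ℂ) :
    margAV (ρ ⊗ₖ ω) = trRight ρ ⊗ₖ ω := by
  ext x y
  simp [margAV, trRight, Finset.sum_mul]

theorem margBV_kronecker (ρ : Matrix (A × B) (A × B) ℂ) (ω : Matrix V V ℂ) :
    margBV (ρ ⊗ₖ ω) = trLeft ρ ⊗ₖ ω := by
  ext x y
  simp [margBV, trLeft, Finset.sum_mul]

theorem trRight_kronecker (ρ : Matrix A A ℂ) {ω : Matrix V V ℂ} (h : ω.trace = 1) :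
    trRight (ρ ⊗ₖ ω) = ρ := by
  ext x y
  simp only [trRight, of_apply, kroneckerMap_apply, ← Finset.mul_sum]
  simp only [Matrix.trace, diag_apply] at h
  rw [h, mul_one]

theorem isExtension_kronecker_one {ρ : Matrix (A × B) (A × B) ℂ} (h : IsState ρ) :
    IsExtension ρ (ρ ⊗ₖ (1 : Matrix (Fin 1) (Fin 1) ℂ)) :=
  ⟨h.kronecker isState_one, trRight_kronecker ρ isState_one.trace_eq_one⟩

theorem infExt_eq {f : ∀ n : ℕ, Matrix ((A × B) × Fin n) ((A × B) × Fin n) ℂ → ℝ}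
    {ρ : Matrix (A × B) (A × B) ℂ} {r : ℝ} (h : ∀ n σ, IsExtension ρ σ → r ≤ f n σ)
    {m : ℕ} {τ : Matrix ((A × B) × Fin m) ((A × B) × Fin m) ℂ} (hτ : IsExtension ρ τ)
    (hf : f m τ = r) : infExt f ρ = (r : EReal) := by
  refine le_antisymm ?_ ?_
  · rw [← hf]
    exact iInf_le_of_le m (iInf_le_of_le τ (iInf_le _ hτ))
  · exact le_iInf fun n => le_iInf fun σ => le_iInf fun hσ => EReal.coe_le_coe_iff.2 (h n σ hσ)

theorem infExt_congr {f g : ∀ n : ℕ, Matrix ((A × B) × Fin n) ((A × B) × Fin n) ℂ → ℝ}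
    {ρ : Matrix (A × B) (A × B) ℂ} (h : ∀ n σ, IsExtension ρ σ → f n σ = g n σ) :
    infExt f ρ = infExt g ρ :=
  iInf_congr fun n => iInf_congr fun σ => iInf_congr fun hσ => by rw [h n σ hσ]

/-- Finiteness of `r` allows it to be subtracted again in `EReal`, even if the infimum is infinite.
-/
theorem coe_add_iInf {ι : Sort*} (r : ℝ) (f : ι → EReal) :
    (r : EReal) + ⨅ i, f i = ⨅ i, ((r : EReal) + f i) := by
  refine le_antisymm (le_iInf fun i => by gcongr; exact iInf_le f i) ?_
  rw [add_comm, ← EReal.sub_le_iff_le_add (by simp) (by simp)]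
  refine le_iInf fun i => ?_
  rw [EReal.sub_le_iff_le_add (by simp) (by simp), add_comm]
  exact iInf_le (fun i => (r : EReal) + f i) i

theorem infExt_const_add (r : ℝ)
    (f : ∀ n : ℕ, Matrix ((A × B) × Fin n) ((A × B) × Fin n) ℂ → ℝ)
    (ρ : Matrix (A × B) (A × B) ℂ) :
    infExt (fun n σ => r + f n σ) ρ = (r : EReal) + infExt f ρ := by
  simp only [infExt, coe_add_iInf, EReal.coe_add]

end Extensions

/-! ### Pure states -/

section PureStates

variable {A B : Type*} [Fintype A] [DecidableEq A] [Fintype B] [DecidableEq B]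

theorem entropies_of_isExtension_pureOp {V : Type*} [Fintype V] [DecidableEq V] {ψ : A × B → ℂ}
    (h : ∑ x, ‖ψ x‖ ^ 2 = 1) {σ : Matrix ((A × B) × V) ((A × B) × V) ℂ}
    (hσ : IsExtension (pureOp ψ) σ) :
    entropy (margAV σ) = entropy (trRight (pureOp ψ)) + entropy (trLeft σ) ∧
      entropy (margBV σ) = entropy (trLeft (pureOp ψ)) + entropy (trLeft σ) ∧
      entropy σ = entropy (trLeft σ) := by
  have hp := isState_pureOp h
  have hV := hσ.isState.trLeft
  have e := eq_kronecker_of_trRight_eq_pureOp h hσ.isState.posSemidef hσ.trRight_eq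
  refine ⟨?_, ?_, ?_⟩
  · rw [← entropy_kronecker hp.trRight hV, ← margAV_kronecker, ← e]
  · rw [← entropy_kronecker hp.trLeft hV, ← margBV_kronecker, ← e]
  · conv_lhs => rw [e]
    rw [entropy_kronecker hp hV, entropy_pureOp h, zero_add]

theorem EP_pureOp {ψ : A × B → ℂ} (h : ∑ x, ‖ψ x‖ ^ 2 = 1) :
    EP (pureOp ψ) = (entropy (trRight (pureOp ψ)) : EReal) := by
  refine infExt_eq (fun n σ hσ => ?_) (isExtension_kronecker_one (isState_pureOp h)) ?_
  · rw [fP, (entropies_of_isExtension_pureOp h hσ).1]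
    exact le_add_of_nonneg_right hσ.isState.trLeft.entropy_nonneg
  · rw [fP, margAV_kronecker, entropy_kronecker (isState_pureOp h).trRight isState_one,
      entropy_one, add_zero]

theorem fQ_of_isExtension_pureOp {V : Type*} [Fintype V] [DecidableEq V] {ψ : A × B → ℂ}
    (h : ∑ x, ‖ψ x‖ ^ 2 = 1) {σ : Matrix ((A × B) × V) ((A × B) × V) ℂ}
    (hσ : IsExtension (pureOp ψ) σ) : fQ σ = entropy (trRight (pureOp ψ)) := by
  obtain ⟨h1, h2, -⟩ := entropies_of_isExtension_pureOp h hσ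
  rw [fQ, h1, h2, hσ.trRight_eq]
  ring

theorem fR_of_isExtension_pureOp {V : Type*} [Fintype V] [DecidableEq V] {ψ : A × B → ℂ}
    (h : ∑ x, ‖ψ x‖ ^ 2 = 1) {σ : Matrix ((A × B) × V) ((A × B) × V) ℂ}
    (hσ : IsExtension (pureOp ψ) σ) : fR σ = entropy (trRight (pureOp ψ)) := by
  obtain ⟨h1, -, h3⟩ := entropies_of_isExtension_pureOp h hσ
  rw [fR, h1, h3, hσ.trRight_eq, entropy_pureOp h]
  ring

theorem EQ_pureOp {ψ : A × B → ℂ} (h : ∑ x, ‖ψ x‖ ^ 2 = 1) :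
    EQ (pureOp ψ) = (entropy (trRight (pureOp ψ)) : EReal) :=
  have hτ := isExtension_kronecker_one (isState_pureOp h)
  infExt_eq (fun _ _ hσ => (fQ_of_isExtension_pureOp h hσ).ge) hτ (fQ_of_isExtension_pureOp h hτ)

theorem ER_pureOp {ψ : A × B → ℂ} (h : ∑ x, ‖ψ x‖ ^ 2 = 1) :
    ER (pureOp ψ) = (entropy (trRight (pureOp ψ)) : EReal) :=
  have hτ := isExtension_kronecker_one (isState_pureOp h)
  infExt_eq (fun _ _ hσ => (fR_of_isExtension_pureOp h hσ).ge) hτ (fR_of_isExtension_pureOp h hτ)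

end PureStates

/-! ### Symmetric and antisymmetric states -/

section Symmetric

variable {ι κ : Type*} [Fintype ι] [DecidableEq ι] [Fintype κ] [DecidableEq κ]

theorem swapOp_mul_apply (M : Matrix (ι × ι) κ ℂ) (x : ι × ι) (y : κ) :
    (swapOp (ι := ι) * M) x y = M x.swap y := by
  rw [Matrix.mul_apply, Finset.sum_eq_single x.swap]
  · simp [swapOp]
  · intro z _ hz
    have : x ≠ z.swap := fun h => hz (by rw [h, Prod.swap_swap])
    simp [swapOp, this]
  · simp

/-- The columns of `ρ` lie in its range, on which the swap acts as a sign. Carrying the sign as `ε`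
treats both cases at once. -/
theorem IsSymOrAntisymState.exists_sign {ρ : Matrix (ι × ι) (ι × ι) ℂ}
    (h : IsSymOrAntisymState ρ) :
    ∃ ε : ℂ, (ε = 1 ∨ ε = -1) ∧ swapOp (ι := ι) * ρ = ε • ρ := by
  have hcol : ∀ y, ρ.col y ∈ LinearMap.range ρ.mulVecLin := fun y =>
    ⟨Pi.single y 1, by rw [mulVecLin_apply, mulVec_single_one]⟩
  rcases h.support_le with hs | hs
  · refine ⟨1, Or.inl rfl, ?_⟩
    ext x y
    rw [swapOp_mul_apply, one_smul]
    exact hs (hcol y) x.1 x.2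
  · refine ⟨-1, Or.inr rfl, ?_⟩
    ext x y
    rw [swapOp_mul_apply, neg_one_smul]
    exact hs (hcol y) x.1 x.2

theorem IsState.isSymOrAntisymState {ρ : Matrix (ι × ι) (ι × ι) ℂ} (h : IsState ρ) {ε : ℂ}
    (hε : ε = 1 ∨ ε = -1) (hρ : swapOp (ι := ι) * ρ = ε • ρ) : IsSymOrAntisymState ρ := by
  have hv : ∀ (v : ι × ι → ℂ) (i j : ι), (ρ *ᵥ v) (j, i) = ε * (ρ *ᵥ v) (i, j) := by
    intro v i j
    simp only [mulVec, dotProduct, Finset.mul_sum]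
    refine Finset.sum_congr rfl fun y _ => ?_
    have := congrFun (congrFun hρ (i, j)) y
    rw [swapOp_mul_apply] at this
    simp only [Prod.swap_prod_mk, Matrix.smul_apply, smul_eq_mul] at this
    rw [this, mul_assoc]
  refine ⟨h, ?_⟩
  rcases hε with rfl | rfl
  · left
    rintro _ ⟨v, rfl⟩ i j
    simpa using hv v i j
  · right
    rintro _ ⟨v, rfl⟩ i j
    simpa using hv v i j

variable {V : Type*} [Fintype V] [DecidableEq V]

/-- `F - ε` annihilates the marginal, hence the extension, so `F ⊗ 1` multiplies `σ` by `ε` from the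
left and, taking adjoints, from the right; the two signs cancel. -/
theorem IsSymOrAntisymState.swap_extension {ρ : Matrix (ι × ι) (ι × ι) ℂ}
    (h : IsSymOrAntisymState ρ) {σ : Matrix ((ι × ι) × V) ((ι × ι) × V) ℂ}
    (hσ : IsExtension ρ σ) :
    (swapOp (ι := ι) ⊗ₖ (1 : Matrix V V ℂ)) * σ *
      ((swapOp (ι := ι))ᴴ ⊗ₖ (1 : Matrix V V ℂ)) = σ := by
  obtain ⟨ε, hε, hρ⟩ := h.exists_sign
  have hK : (swapOp (ι := ι) - ε • (1 : Matrix (ι × ι) (ι × ι) ℂ)) * trRight σ = 0 := by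
    rw [hσ.trRight_eq, Matrix.sub_mul, hρ, Matrix.smul_mul, Matrix.one_mul, sub_self]
  have h0 := kronecker_one_mul_eq_zero hσ.isState.posSemidef hK
  rw [sub_kronecker, smul_kronecker, one_kronecker_one, Matrix.sub_mul, Matrix.smul_mul,
    Matrix.one_mul, sub_eq_zero] at h0
  have h1 := congrArg conjTranspose h0
  rw [conjTranspose_mul, conjTranspose_kronecker, conjTranspose_one, conjTranspose_smul,
    hσ.isState.posSemidef.1.eq] at h1
  rw [h0, Matrix.smul_mul, h1, smul_smul]
  rcases hε with rfl | rfl <;> simp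

theorem swap_conj_apply (σ : Matrix ((ι × ι) × V) ((ι × ι) × V) ℂ) (x y : ι × ι) (v w : V) :
    ((swapOp (ι := ι) ⊗ₖ (1 : Matrix V V ℂ)) * σ *
      ((swapOp (ι := ι))ᴴ ⊗ₖ (1 : Matrix V V ℂ))) (x, v) (y, w) =
      σ (x.swap, v) (y.swap, w) := by
  have h : ∀ (M : Matrix ((ι × ι) × V) ((ι × ι) × V) ℂ) (x : ι × ι) (v : V) z,
      ((swapOp (ι := ι) ⊗ₖ (1 : Matrix V V ℂ)) * M) (x, v) z = M (x.swap, v) z := by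
    intro M x v z
    rw [Matrix.mul_apply, Finset.sum_eq_single (x.swap, v)]
    · simp [swapOp]
    · rintro ⟨x', v'⟩ _ hz
      by_cases hv : v = v'
      · have : x ≠ x'.swap := fun h => hz (by rw [h, Prod.swap_swap, hv])
        simp [swapOp, this]
      · simp [hv]
    · simp
  have e : σ * ((swapOp (ι := ι))ᴴ ⊗ₖ (1 : Matrix V V ℂ)) =
      ((swapOp (ι := ι) ⊗ₖ (1 : Matrix V V ℂ)) * σᴴ)ᴴ := by
    rw [conjTranspose_mul, conjTranspose_conjTranspose, conjTranspose_kronecker, conjTranspose_one]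
  rw [Matrix.mul_assoc, h, e, conjTranspose_apply, h, conjTranspose_apply, star_star]

theorem IsSymOrAntisymState.margAV_eq {ρ : Matrix (ι × ι) (ι × ι) ℂ}
    (h : IsSymOrAntisymState ρ) {σ : Matrix ((ι × ι) × V) ((ι × ι) × V) ℂ}
    (hσ : IsExtension ρ σ) : margAV σ = margBV σ := by
  ext x y
  simp only [margAV, margBV, of_apply]
  refine Finset.sum_congr rfl fun b _ => ?_
  conv_lhs => rw [← h.swap_extension hσ, swap_conj_apply]
  rfl

theorem IsSymOrAntisymState.trRight_eq {ρ : Matrix (ι × ι) (ι × ι) ℂ}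
    (h : IsSymOrAntisymState ρ) : trRight ρ = trLeft ρ := by
  have := h.margAV_eq (isExtension_kronecker_one h.isState)
  rw [margAV_kronecker, margBV_kronecker] at this
  rw [← trRight_kronecker (trRight ρ) isState_one.trace_eq_one, this,
    trRight_kronecker _ isState_one.trace_eq_one]

/-- With `S_AV = S_BV` and `S_A = S_B`, weak monotonicity reads `2 S_A ≤ 2 S_AV`; a one-dimensional
`V` attains equality. -/
theorem IsSymOrAntisymState.EP_eq {ρ : Matrix (ι × ι) (ι × ι) ℂ} (h : IsSymOrAntisymState ρ) :
    EP ρ = (entropy (trRight ρ) : EReal) := by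
  refine infExt_eq (fun n σ hσ => ?_) (isExtension_kronecker_one h.isState) ?_
  · have := entropy_add_entropy_le hσ.isState.posSemidef
    rw [← h.margAV_eq hσ, hσ.trRight_eq, ← h.trRight_eq] at this
    rw [fP]
    linarith
  · rw [fP, margAV_kronecker, entropy_kronecker h.isState.trRight isState_one, entropy_one,
      add_zero]

theorem IsSymOrAntisymState.fQ_eq {ρ : Matrix (ι × ι) (ι × ι) ℂ}
    (h : IsSymOrAntisymState ρ) {σ : Matrix ((ι × ι) × V) ((ι × ι) × V) ℂ}
    (hσ : IsExtension ρ σ) : fQ σ = entropy (trRight ρ) := by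
  rw [fQ, h.margAV_eq hσ, hσ.trRight_eq, ← h.trRight_eq]
  ring

theorem IsSymOrAntisymState.EQ_eq {ρ : Matrix (ι × ι) (ι × ι) ℂ} (h : IsSymOrAntisymState ρ) :
    EQ ρ = (entropy (trRight ρ) : EReal) :=
  have hτ := isExtension_kronecker_one h.isState
  infExt_eq (fun _ _ hσ => (h.fQ_eq hσ).ge) hτ (h.fQ_eq hτ)

theorem IsSymOrAntisymState.ER_eq {ρ : Matrix (ι × ι) (ι × ι) ℂ} (h : IsSymOrAntisymState ρ) :
    ER ρ = ((1 / 2 * entropy ρ : ℝ) : EReal) + Esq ρ := by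
  rw [Esq, ← infExt_const_add, ER]
  refine infExt_congr fun n σ hσ => ?_
  rw [fR, condMutualInfo, ← h.margAV_eq hσ, hσ.trRight_eq]
  ring

theorem trRight_bipartiteTensor (ρ : Matrix (ι × ι) (ι × ι) ℂ) (τ : Matrix (κ × κ) (κ × κ) ℂ) :
    trRight (bipartiteTensor ρ τ) = trRight ρ ⊗ₖ trRight τ := by
  ext x y
  simp only [trRight, bipartiteTensor, of_apply, kroneckerMap_apply, Fintype.sum_prod_type,
    Finset.sum_mul_sum]

theorem isState_bipartiteTensor {ρ : Matrix (ι × ι) (ι × ι) ℂ} {τ : Matrix (κ × κ) (κ × κ) ℂ}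
    (hρ : IsState ρ) (hτ : IsState τ) : IsState (bipartiteTensor ρ τ) := by
  refine ⟨?_, ?_⟩
  · have : bipartiteTensor ρ τ = (ρ ⊗ₖ τ).submatrix (Equiv.prodProdProdComm ι κ ι κ)
        (Equiv.prodProdProdComm ι κ ι κ) := rfl
    rw [this]
    exact (hρ.kronecker hτ).posSemidef.submatrix _
  · rw [← trace_trRight, trRight_bipartiteTensor, trace_kronecker, trace_trRight, trace_trRight,
      hρ.trace_eq_one, hτ.trace_eq_one, mul_one]

/-- The swap of `A₁A₂` with `B₁B₂` is the product of the two swaps, so the signs multiply; in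
particular, two antisymmetric factors give a symmetric state. -/
theorem IsSymOrAntisymState.bipartiteTensor {ρ : Matrix (ι × ι) (ι × ι) ℂ}
    {τ : Matrix (κ × κ) (κ × κ) ℂ} (hρ : IsSymOrAntisymState ρ) (hτ : IsSymOrAntisymState τ) :
    IsSymOrAntisymState (bipartiteTensor ρ τ) := by
  obtain ⟨ε, hε, h1⟩ := hρ.exists_sign
  obtain ⟨δ, hδ, h2⟩ := hτ.exists_sign
  refine (isState_bipartiteTensor hρ.isState hτ.isState).isSymOrAntisymState (ε := ε * δ) ?_ ?_
  · rcases hε with rfl | rfl <;> rcases hδ with rfl | rfl <;> simp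
  · ext x y
    have e1 := congrFun (congrFun h1 (x.1.1, x.2.1)) (y.1.1, y.2.1)
    have e2 := congrFun (congrFun h2 (x.1.2, x.2.2)) (y.1.2, y.2.2)
    rw [swapOp_mul_apply, Matrix.smul_apply, smul_eq_mul] at e1 e2
    rw [swapOp_mul_apply, Matrix.smul_apply, smul_eq_mul]
    simp only [QCorr.bipartiteTensor, of_apply, Prod.fst_swap, Prod.snd_swap]
    simp only [Prod.swap_prod_mk] at e1 e2
    rw [e1, e2]
    ring

theorem EP_bipartiteTensor {ρ : Matrix (ι × ι) (ι × ι) ℂ} {τ : Matrix (κ × κ) (κ × κ) ℂ}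
    (hρ : IsSymOrAntisymState ρ) (hτ : IsSymOrAntisymState τ) :
    EP (bipartiteTensor ρ τ) = EP ρ + EP τ := by
  rw [(hρ.bipartiteTensor hτ).EP_eq, hρ.EP_eq, hτ.EP_eq, trRight_bipartiteTensor,
    entropy_kronecker hρ.isState.trRight hτ.isState.trRight, EReal.coe_add]

end Symmetric

/-! ### Classically correlated states -/

section Classical

variable {ι : Type*} [Fintype ι] [DecidableEq ι]

theorem shannon_eq_sum_negMulLog (p : ι → ℝ) : shannon p = ∑ i, Real.negMulLog (p i) := by
  simp [shannon, Real.negMulLog]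

theorem classicalState_eq_diagonal (p : ι → ℝ) :
    classicalState p = diagonal fun x => ((if x.1 = x.2 then p x.1 else 0 : ℝ) : ℂ) := by
  ext ⟨i, j⟩ ⟨k, l⟩
  simp only [classicalState, Matrix.sum_apply, Matrix.smul_apply, pureOp, vecMulVec_apply, Pi.star_apply,
    Pi.single_apply, Prod.mk.injEq, smul_eq_mul, diagonal_apply]
  by_cases hij : i = j
  · subst hij
    rw [Finset.sum_eq_single i]
    · by_cases hk : i = k <;> by_cases hl : i = l <;> simp [hk, hl, Ne.symm]
      all_goals grind
    · intro m _ hm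
      simp [hm.symm]
    · simp
  · rw [Finset.sum_eq_zero]
    · simp [hij]
    · intro m _
      have : ¬(i = m ∧ j = m) := fun h => hij (h.1.trans h.2.symm)
      simp [this]

theorem trRight_classicalState (p : ι → ℝ) :
    trRight (classicalState p) = diagonal fun i => (p i : ℂ) := by
  rw [classicalState_eq_diagonal]
  ext i j
  by_cases h : i = j <;> simp [trRight, diagonal_apply, h, apply_ite Complex.ofReal]

theorem posSemidef_diagonal_ofReal {X : Type*} [Fintype X] [DecidableEq X] {p : X → ℝ}
    (hp : ∀ i, 0 ≤ p i) : (diagonal fun i => (p i : ℂ)).PosSemidef :=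
  PosSemidef.diagonal fun i => by simpa using hp i

/-- The support is spanned by vectors `|ii⟩`, which are swap invariant; the results on symmetric
states therefore apply. -/
theorem isSymOrAntisymState_classicalState {p : ι → ℝ} (hp : ∀ i, 0 ≤ p i)
    (hsum : ∑ i, p i = 1) : IsSymOrAntisymState (classicalState p) := by
  have hs : IsState (classicalState p) := by
    refine ⟨?_, ?_⟩
    · rw [classicalState_eq_diagonal]
      refine posSemidef_diagonal_ofReal fun x => ?_
      split_ifs
      exacts [hp _, le_rfl]
    · rw [← trace_trRight, trRight_classicalState, trace_diagonal, ← Complex.ofReal_sum, hsum,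
        Complex.ofReal_one]
  refine hs.isSymOrAntisymState (Or.inl rfl) ?_
  ext ⟨i, j⟩ y
  rw [swapOp_mul_apply, one_smul, classicalState_eq_diagonal]
  by_cases h : i = j
  · simp [h]
  · simp [diagonal_apply, h, Ne.symm h]

theorem entropy_trRight_classicalState (p : ι → ℝ) :
    entropy (trRight (classicalState p)) = shannon p := by
  rw [trRight_classicalState, entropy_diagonal, shannon_eq_sum_negMulLog]

theorem entropy_classicalState (p : ι → ℝ) : entropy (classicalState p) = shannon p := by
  rw [classicalState_eq_diagonal, entropy_diagonal, shannon_eq_sum_negMulLog,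
    Fintype.sum_prod_type]
  simp [apply_ite Real.negMulLog]

/-- The extension `∑ i, p i |iii⟩⟨iii|` of the classically correlated state. -/
def copyExtension {V : Type*} [Fintype V] [DecidableEq V] (p : ι → ℝ) (e : ι ≃ V) :
    Matrix ((ι × ι) × V) ((ι × ι) × V) ℂ :=
  diagonal fun x => ((if x.1.1 = x.1.2 then if e x.1.1 = x.2 then p x.1.1 else 0 else 0 : ℝ) : ℂ)

variable {V : Type*} [Fintype V] [DecidableEq V]

theorem isExtension_copyExtension {p : ι → ℝ} (hp : ∀ i, 0 ≤ p i) (hsum : ∑ i, p i = 1)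
    (e : ι ≃ V) : IsExtension (classicalState p) (copyExtension p e) := by
  have h : trRight (copyExtension p e) = classicalState p := by
    rw [classicalState_eq_diagonal]
    ext x y
    by_cases h : x = y
    · subst h
      by_cases hx : x.1 = x.2 <;> simp [trRight, copyExtension, hx, apply_ite Complex.ofReal]
    · simp [trRight, copyExtension, diagonal_apply, h]
  refine ⟨⟨?_, ?_⟩, h⟩
  · refine posSemidef_diagonal_ofReal fun x => ?_
    split_ifs
    exacts [hp _, le_rfl, le_rfl]
  · rw [← trace_trRight, h]
    exact (isSymOrAntisymState_classicalState hp hsum).isState.trace_eq_one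

theorem entropy_copyExtension (p : ι → ℝ) (e : ι ≃ V) :
    entropy (copyExtension p e) = shannon p := by
  rw [copyExtension, entropy_diagonal, shannon_eq_sum_negMulLog]
  simp [Fintype.sum_prod_type, apply_ite Real.negMulLog]

theorem entropy_margBV_copyExtension (p : ι → ℝ) (e : ι ≃ V) :
    entropy (margBV (copyExtension p e)) = shannon p := by
  have : margBV (copyExtension p e) =
      diagonal fun x => ((if e x.1 = x.2 then p x.1 else 0 : ℝ) : ℂ) := by
    ext x y
    by_cases h : x = y
    · subst h
      simp [margBV, copyExtension, apply_ite Complex.ofReal]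
    · have : ¬(x.1 = y.1 ∧ x.2 = y.2) := fun h' => h (Prod.ext h'.1 h'.2)
      simp [margBV, copyExtension, diagonal_apply, h, this]
  rw [this, entropy_diagonal, shannon_eq_sum_negMulLog]
  simp [Fintype.sum_prod_type, apply_ite Real.negMulLog]

theorem entropy_trLeft_copyExtension (p : ι → ℝ) (e : ι ≃ V) :
    entropy (trLeft (copyExtension p e)) = shannon p := by
  have : trLeft (copyExtension p e) = diagonal fun v => ((p (e.symm v) : ℝ) : ℂ) := by
    ext x y
    by_cases h : x = y
    · subst h
      simp [trLeft, copyExtension, Fintype.sum_prod_type, apply_ite Complex.ofReal,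
        ← Equiv.eq_symm_apply]
    · simp [trLeft, copyExtension, diagonal_apply, h]
  rw [this, entropy_diagonal, shannon_eq_sum_negMulLog]
  exact e.symm.sum_comp fun i => Real.negMulLog (p i)

/-- Strong subadditivity gives the lower bound. In the copy extension `S_AV`, `S_BV`, `S_ABV` and
`S_V` all equal `H(p)`, so the conditional mutual information is zero. -/
theorem Esq_classicalState {p : ι → ℝ} (hp : ∀ i, 0 ≤ p i) (hsum : ∑ i, p i = 1) :
    Esq (classicalState p) = 0 := by
  have hτ := isExtension_copyExtension hp hsum (Fintype.equivFin ι)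
  refine infExt_eq (r := 0) (fun n σ hσ => ?_) hτ ?_
  · exact mul_nonneg (by norm_num) (condMutualInfo_nonneg hσ.isState.posSemidef)
  · rw [condMutualInfo, (isSymOrAntisymState_classicalState hp hsum).margAV_eq hτ,
      entropy_margBV_copyExtension, entropy_copyExtension, entropy_trLeft_copyExtension]
    ring

end Classical

end QCorr

end

open QCorr in
open scoped Kronecker in
theorem mainTheorem5 {A B ι κ : Type*} [Fintype A] [DecidableEq A] [Fintype B] [DecidableEq B]
    [Fintype ι] [DecidableEq ι] [Fintype κ] [DecidableEq κ] :
    -- pure states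
    (∀ ψ : A × B → ℂ, ∑ x, ‖ψ x‖ ^ 2 = 1 →
      EP (pureOp ψ) = (entropy (trRight (pureOp ψ)) : EReal) ∧
      EQ (pureOp ψ) = (entropy (trRight (pureOp ψ)) : EReal) ∧
      ER (pureOp ψ) = (entropy (trRight (pureOp ψ)) : EReal) ∧
      entropy (trRight (pureOp ψ)) = entropy (trLeft (pureOp ψ))) ∧
    -- classically correlated states
    (∀ p : ι → ℝ, (∀ i, 0 ≤ p i) → ∑ i, p i = 1 →
      entropy (trRight (classicalState p)) = shannon p ∧
      mutualInfo (classicalState p) = shannon p ∧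
      EP (classicalState p) = (shannon p : EReal) ∧
      EQ (classicalState p) = (shannon p : EReal) ∧
      ER (classicalState p) = ((1 / 2 * shannon p : ℝ) : EReal)) ∧
    -- states supported on the symmetric or on the antisymmetric subspace
    (∀ ρ : Matrix (ι × ι) (ι × ι) ℂ, IsSymOrAntisymState ρ →
      (∀ (n : ℕ) (σ : Matrix ((ι × ι) × Fin n) ((ι × ι) × Fin n) ℂ), IsExtension ρ σ →
        (swapOp ⊗ₖ (1 : Matrix (Fin n) (Fin n) ℂ)) * σ *
          ((swapOp : Matrix (ι × ι) (ι × ι) ℂ).conjTranspose ⊗ₖ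
            (1 : Matrix (Fin n) (Fin n) ℂ)) = σ ∧
        entropy (margAV σ) = entropy (margBV σ)) ∧
      EP ρ = (entropy (trRight ρ) : EReal) ∧
      EQ ρ = (entropy (trRight ρ) : EReal) ∧
      ER ρ = ((1 / 2 * entropy ρ : ℝ) : EReal) + Esq ρ) ∧
    -- additivity of the entanglement of purification on the latter class
    (∀ (ρ : Matrix (ι × ι) (ι × ι) ℂ) (τ : Matrix (κ × κ) (κ × κ) ℂ),
      IsSymOrAntisymState ρ → IsSymOrAntisymState τ →
      EP (bipartiteTensor ρ τ) = EP ρ + EP τ) := by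
  refine ⟨fun ψ hψ => ⟨EP_pureOp hψ, EQ_pureOp hψ, ER_pureOp hψ, entropy_trRight_pureOp ψ⟩,
    fun p hp hsum => ?_,
    fun ρ hρ => ⟨fun n σ hσ => ⟨hρ.swap_extension hσ, by rw [hρ.margAV_eq hσ]⟩, hρ.EP_eq, hρ.EQ_eq,
      hρ.ER_eq⟩,
    fun ρ τ hρ hτ => EP_bipartiteTensor hρ hτ⟩
  have h := isSymOrAntisymState_classicalState hp hsum
  have hS := entropy_trRight_classicalState p
  refine ⟨hS, ?_, by rw [h.EP_eq, hS], by rw [h.EQ_eq, hS], ?_⟩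
  · rw [mutualInfo, ← h.trRight_eq, hS, entropy_classicalState]
    ring
  · rw [h.ER_eq, Esq_classicalState hp hsum, entropy_classicalState, add_zero]
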